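/- **Conventions.** Consider the constructors $0,1$ (of arity $0$) and $\mathrm{cons}$ (of arity $2$, written $s:t$), the inductive data predicate $B$ (booleans) and the coinductive data predicate $S$ (streams of booleans). Fix infinitely many further function identifiers of each arity; together with the destructors $\mathrm{hd},\mathrm{tl}$ (unary) and the discriminator $\delta$ (of arity $4$) they are the *program-functions*. *Programs.* A *$k$-ary equational program* $(P,\mathbf f)$ is a finite set $P$ of equations $\mathbf g(t_1,\dots,t_n)=q$, with $\mathbf g$ a program-function, the $t_i$ built from variables and constructors, $q$ any term, and with pairwise non-unifiable left-hand sides, together with a $k$-ary program-function $\mathbf f$. $P$ is required to contain the equations $$\mathrm{hd}(x:y)=x,\quad \mathrm{tl}(x:y)=y,\quad \mathrm{hd}(c)=\mathrm{tl}(c)=c\ \ (c=0,1),$$ $$\delta(0,x,y,z)=x,\quad \delta(1,x,y,z)=y,\quad \delta(u:w,x,y,z)=z.$$ *Computation.* Let $\mathcal A$ be the canonical structure of all finite and infinite terms over $0,1,\mathrm{cons}$; a stream $b_0b_1b_2\cdots\in\{0,1\}^{\mathbb N}$ is identified with the infinite term $b_0:b_1:b_2:\cdots$. Let $\mathrm{Diag}$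 be the set of equations $v_{c(b_1,\dots,b_r)}=c(v_{b_1},\dots,v_{b_r})$, for $c$ an $r$-ary constructor and $b_i\in\mathcal A$, where the $v_a$ $(a\in\mathcal A)$ are fresh constants. Write $P\vdash^\omega t=t'$ if for every composition $\Pi$ of destructors (the empty one included) the equation $\delta(\Pi(t),x,y,z)=\delta(\Pi(t'),x,y,z)$ is derivable in equational logic from $P\cup\mathrm{Diag}$. The program $(P,\mathbf f)$ *computes* $F:(\{0,1\}^{\mathbb N})^k\to\{0,1\}^{\mathbb N}$ if for all streams $a_1,\dots,a_k$ and all $b\in\mathcal A$: $\ P\vdash^\omega \mathbf f(v_{a_1},\dots,v_{a_k})=v_b$ if and only if $b=F(a_1,\dots,a_k)$. *The theory $\mathrm{IT}^+$.* This is the theory in first-order minimal logic with equality, over the function identifiers above and the predicates $B,S$, with injectivity of $\mathrm{cons}$; separation axioms stating that distinct constructors have disjoint images; the rules $B(0)$, $B(1)$; induction for $B$ (from $B(t)$, $\varphi[0]$, $\varphi[1]$ infer $\varphi[t]$); the data-elimination rules for streams, i.e. from $S(x:y)$ infer $B(x)$ and $S(y)$, and from $S(t)$ infer $\exists z_0\exists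 z_1\,(B(z_0)\wedge S(z_1)\wedge t=z_0:z_1)$; and coinduction for $S$: from $\varphi[t]$ and a derivation of $\exists z_0\exists z_1\,(B(z_0)\wedge\varphi[z_1]\wedge x=z_0:z_1)$ from the assumption $\varphi[x]$ ($x$ not free in other open assumptions) infer $S(t)$, where $\varphi$ must be *strongly positive*, i.e. built from formulas $B(t)$, $S(t)$, $t=t'$ using only $\wedge,\vee,\exists$. A program $(P,\mathbf f)$ is *provable in $\mathrm{IT}^+$* if $S(x_1)\to\cdots\to S(x_k)\to S(\mathbf f(x_1,\dots,x_k))$ is derivable in $\mathrm{IT}^+$ from the universal closures of the equations in $P$. *Primitive corecursion.* The *primitive corecursive* functions over booleans and boolean streams (each argument and the value being of one of these two sorts) are those generated from the constructors $0,1$ and $\mathrm{cons}$ (boolean, stream $\mapsto$ stream), the destructors $\mathrm{hd}$ (stream $\mapsto$ boolean) and $\mathrm{tl}$ (stream $\mapsto$ stream), and the discriminator (the definition by cases $(b,x_0,x_1)\mapsto x_b$, with $b$ a boolean and $x_0,x_1$ of the same sort), by composition (with projections) and corecurrence: from $h_j$ (boolean-valued), indices $\ell_j$ and tuples $\vec g_j$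 define stream-valued $f_1,\dots,f_m$ by $$f_j(\vec x)=h_j(\vec x):f_{\ell_j}(\vec g_j(\vec x))\qquad(j=1,\dots,m).$$ **Theorem.** Let $k\ge 0$ and let $F:(\{0,1\}^{\mathbb N})^k\to\{0,1\}^{\mathbb N}$. Then $F$ is primitive corecursive if and only if there is a $k$-ary equational program $(P,\mathbf f)$ that computes $F$ and is provable in $\mathrm{IT}^+$. -/

import Mathlib

open FirstOrder

namespace BoolStream

/-! ### Terms and equational programs -/

/-- The constructors of the data system of boolean streams, indexed by arity. -/
inductive Con : ℕ → Type
  | zero : Con 0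
  | one : Con 0
  | cons : Con 2

/-- The program-functions, indexed by arity: the two destructors, the discriminator `δ₃` and, for
each arity `n`, infinitely many further identifiers. -/
inductive PFn : ℕ → Type
  | hd : PFn 1
  | tl : PFn 1
  | disc : PFn 4
  | user (n i : ℕ) : PFn n

/-- All function identifiers. -/
inductive Sym (n : ℕ) : Type
  | con (c : Con n) : Sym n
  | fn (f : PFn n) : Sym n

/-- The function identifiers as a first-order language. The data predicates `B` and `S` occur only
in formulas, see `Fml`. -/
abbrev lang : Language where
  Functions := Sym
  Relations := fun _ => Empty

/-- Program-terms with variables from `α`. -/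
abbrev Trm (α : Type) : Type := lang.Term α

namespace Trm

variable {α : Type}

/-- A constructor applied to terms. -/
def con {n : ℕ} (c : Con n) (ts : Fin n → Trm α) : Trm α :=
  Language.Term.func (L := lang) (Sym.con c) ts

/-- A program-function applied to terms. -/
def fn {n : ℕ} (f : PFn n) (ts : Fin n → Trm α) : Trm α :=
  Language.Term.func (L := lang) (Sym.fn f) ts

/-- A variable. -/
def var (a : α) : Trm α := Language.Term.var a

/-- The term `0`. -/
def zero : Trm α := con Con.zero ![]

/-- The term `1`. -/
def one : Trm α := con Con.one ![]

/-- The term `s : t`. -/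
def cons (s t : Trm α) : Trm α := con Con.cons ![s, t]

/-- The term `hd t`. -/
def hd (t : Trm α) : Trm α := fn PFn.hd ![t]

/-- The term `tl t`. -/
def tl (t : Trm α) : Trm α := fn PFn.tl ![t]

/-- The term `δ(t, x, y, z)`. -/
def disc (t x y z : Trm α) : Trm α := fn PFn.disc ![t, x, y, z]

end Trm

/-- Base-terms: built from variables and constructors only. -/
inductive IsBase : Trm ℕ → Prop
  | var (x : ℕ) : IsBase (Trm.var x)
  | con {n : ℕ} (c : Con n) (ts : Fin n → Trm ℕ) :
      (∀ i, IsBase (ts i)) → IsBase (Trm.con c ts)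

/-- An equation `f(t₁, …, tₖ) = q` for a program-function `f`. -/
structure Equation where
  arity : ℕ
  fn : PFn arity
  args : Fin arity → Trm ℕ
  rhs : Trm ℕ

/-- The definiendum of an equation. -/
def Equation.lhs (e : Equation) : Trm ℕ := Trm.fn e.fn e.args

/-- Unifiability of two terms after renaming their variables apart. -/
def Unifiable (s t : Trm ℕ) : Prop :=
  ∃ σ τ : ℕ → Trm ℕ, s.subst σ = t.subst τ

/-- The equations for the destructors and the discriminator, part of every program. -/
def stdEqs : Set Equation :=
  { ⟨1, PFn.hd, ![Trm.zero], Trm.zero⟩,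
    ⟨1, PFn.hd, ![Trm.one], Trm.one⟩,
    ⟨1, PFn.hd, ![Trm.cons (Trm.var 0) (Trm.var 1)], Trm.var 0⟩,
    ⟨1, PFn.tl, ![Trm.zero], Trm.zero⟩,
    ⟨1, PFn.tl, ![Trm.one], Trm.one⟩,
    ⟨1, PFn.tl, ![Trm.cons (Trm.var 0) (Trm.var 1)], Trm.var 1⟩,
    ⟨4, PFn.disc, ![Trm.zero, Trm.var 0, Trm.var 1, Trm.var 2], Trm.var 0⟩,
    ⟨4, PFn.disc, ![Trm.one, Trm.var 0, Trm.var 1, Trm.var 2], Trm.var 1⟩,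
    ⟨4, PFn.disc, ![Trm.cons (Trm.var 3) (Trm.var 4), Trm.var 0, Trm.var 1, Trm.var 2],
      Trm.var 2⟩ }

/-- A `k`-ary equational program: a finite set of pairwise compatible program-equations, with the
equations for destructors and discriminator among them, and a principal function. -/
structure Program (k : ℕ) where
  eqs : Set Equation
  finite : eqs.Finite
  base : ∀ e ∈ eqs, ∀ i, IsBase (e.args i)
  compatible : eqs.Pairwise fun e e' => ¬ Unifiable e.lhs e'.lhs
  std : stdEqs ⊆ eqs
  principal : PFn k

/-! ### The canonical structure and computation over it -/

/-- The signature functor of the constructors. -/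
abbrev conFunctor : PFunctor where
  A := Σ n, Con n
  B := fun c => Fin c.1

/-- The universe of the canonical structure: all finite and infinite terms (trees) over the
constructors. -/
abbrev Tree : Type := conFunctor.M

/-- The interpretation of a constructor in the canonical structure. -/
def Tree.con {n : ℕ} (c : Con n) (ts : Fin n → Tree) : Tree :=
  PFunctor.M.mk (F := conFunctor) ⟨⟨n, c⟩, ts⟩

/-- One unfolding step of a boolean or a boolean stream: its main constructor and arguments. -/
def unfoldStep : Bool ⊕ Stream' Bool → conFunctor (Bool ⊕ Stream' Bool)
  | Sum.inl false => ⟨⟨0, Con.zero⟩, ![]⟩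
  | Sum.inl true => ⟨⟨0, Con.one⟩, ![]⟩
  | Sum.inr s => ⟨⟨2, Con.cons⟩, ![Sum.inl s.head, Sum.inr s.tail]⟩

/-- A boolean stream `s` as the infinite term `s₀ : s₁ : s₂ : …`. -/
def Tree.ofStream (s : Stream' Bool) : Tree :=
  PFunctor.M.corec unfoldStep (Sum.inr s)

/-- Terms over the function identifiers and a constant `v_a` for each element `a` of the canonical
structure. The generators `Sum.inl a` are the constants, the generators `Sum.inr x` the variables;
nothing is ever substituted for a constant. -/
abbrev DTrm : Type := Trm (Tree ⊕ ℕ)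

/-- The constant `v_a`. -/
def DTrm.const (a : Tree) : DTrm := Trm.var (Sum.inl a)

/-- Derivability in equational logic from the equations in `E` and the diagram of the canonical
structure. -/
inductive EqDeriv (E : Set Equation) : DTrm → DTrm → Prop
  | prog (e : Equation) (he : e ∈ E) (σ : ℕ → DTrm) :
      EqDeriv E (e.lhs.subst σ) (e.rhs.subst σ)
  | diag {n : ℕ} (c : Con n) (b : Fin n → Tree) :
      EqDeriv E (DTrm.const (Tree.con c b)) (Trm.con c fun i => DTrm.const (b i))
  | refl (t : DTrm) : EqDeriv E t t
  | symm {s t : DTrm} : EqDeriv E s t → EqDeriv E t s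
  | trans {s t u : DTrm} : EqDeriv E s t → EqDeriv E t u → EqDeriv E s u
  | congr {n : ℕ} (f : Sym n) (ts us : Fin n → DTrm) : (∀ i, EqDeriv E (ts i) (us i)) →
      EqDeriv E (Language.Term.func (L := lang) f ts) (Language.Term.func (L := lang) f us)

/-- The deep destructor given by a list of destructors (`false` for `hd`, `true` for `tl`). -/
def deepDestr : List Bool → DTrm → DTrm
  | [], t => t
  | false :: p, t => Trm.hd (deepDestr p t)
  | true :: p, t => Trm.tl (deepDestr p t)

/-- The relation `⊢^ω`: all finite observations of `s` and `t` are provably equal. -/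
def OmegaDeriv (E : Set Equation) (s t : DTrm) : Prop :=
  ∀ p : List Bool, EqDeriv E
    (Trm.disc (deepDestr p s) (Trm.var (Sum.inr 0)) (Trm.var (Sum.inr 1)) (Trm.var (Sum.inr 2)))
    (Trm.disc (deepDestr p t) (Trm.var (Sum.inr 0)) (Trm.var (Sum.inr 1)) (Trm.var (Sum.inr 2)))

/-- The program `P` computes the function `F` on streams over the canonical structure. -/
def Program.Computes {k : ℕ} (P : Program k)
    (F : (Fin k → Stream' Bool) → Stream' Bool) : Prop :=
  ∀ (a : Fin k → Stream' Bool) (b : Tree),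
    OmegaDeriv P.eqs (Trm.fn P.principal fun i => DTrm.const (Tree.ofStream (a i)))
      (DTrm.const b) ↔ Tree.ofStream (F a) = b

/-! ### The intrinsic theory -/

/-- First-order formulas with data predicates `B` and `S`; variables are de Bruijn indices. -/
inductive Fml : Type
  | B (t : Trm ℕ) : Fml
  | S (t : Trm ℕ) : Fml
  | eq (s t : Trm ℕ) : Fml
  | bot : Fml
  | and (φ ψ : Fml) : Fml
  | or (φ ψ : Fml) : Fml
  | imp (φ ψ : Fml) : Fml
  | all (φ : Fml) : Fml
  | ex (φ : Fml) : Fml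

/-- A substitution moved under a quantifier. -/
def liftSubst (σ : ℕ → Trm ℕ) : ℕ → Trm ℕ
  | 0 => Trm.var 0
  | n + 1 => (σ n).subst fun x => Trm.var (x + 1)

namespace Fml

/-- Capture-avoiding simultaneous substitution. -/
def subst : (ℕ → Trm ℕ) → Fml → Fml
  | σ, B t => B (Language.Term.subst t σ)
  | σ, S t => S (Language.Term.subst t σ)
  | σ, eq s t => eq (Language.Term.subst s σ) (Language.Term.subst t σ)
  | _, bot => bot
  | σ, and φ ψ => and (subst σ φ) (subst σ ψ)
  | σ, or φ ψ => or (subst σ φ) (subst σ ψ)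
  | σ, imp φ ψ => imp (subst σ φ) (subst σ ψ)
  | σ, all φ => all (subst (liftSubst σ) φ)
  | σ, ex φ => ex (subst (liftSubst σ) φ)

/-- Weakening by a fresh variable, which gets the index `0`. -/
def shift (φ : Fml) : Fml := φ.subst fun n => Trm.var (n + 1)

/-- `φ[t]`: the variable `0` is replaced by `t` and removed. -/
def inst (φ : Fml) (t : Trm ℕ) : Fml :=
  φ.subst fun n => match n with
    | 0 => t
    | m + 1 => Trm.var m

/-- Strongly positive formulas: built from atomic formulas `B(t)`, `S(t)`, `s = t` by `∧`, `∨`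
and `∃`. -/
inductive StronglyPositive : Fml → Prop
  | B (t : Trm ℕ) : StronglyPositive (Fml.B t)
  | S (t : Trm ℕ) : StronglyPositive (Fml.S t)
  | eq (s t : Trm ℕ) : StronglyPositive (Fml.eq s t)
  | and {φ ψ : Fml} : StronglyPositive φ → StronglyPositive ψ → StronglyPositive (φ.and ψ)
  | or {φ ψ : Fml} : StronglyPositive φ → StronglyPositive ψ → StronglyPositive (φ.or ψ)
  | ex {φ : Fml} : StronglyPositive φ → StronglyPositive φ.ex

/-- For `φ = φ[x]` with `x` the variable `0`, the formula
`∃ z₀ ∃ z₁ (B(z₀) ∧ φ[z₁] ∧ x = z₀ : z₁)`. Under the two quantifiers `z₁`, `z₀`, `x` have the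
indices `0`, `1`, `2`, and the variable `n + 1` of `φ` has the index `n + 3`. -/
def dcm (φ : Fml) : Fml :=
  ex (ex (and (B (Trm.var 1))
    (and
      (φ.subst fun n => match n with
        | 0 => Trm.var 0
        | m + 1 => Trm.var (m + 3))
      (eq (Trm.var 2) (Trm.cons (Trm.var 1) (Trm.var 0))))))

end Fml

/-- Natural deduction for `IT⁺` with the equations in `E` as axioms: first-order minimal logic with
equality, the rules for the data predicates, and coinduction for strongly positive formulas.
`Prov E Γ φ` says that `φ` is derivable from the open assumptions `Γ`. -/
inductive Prov (E : Set Equation) : List Fml → Fml → Prop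
  -- minimal logic
  | hyp {Γ : List Fml} {φ : Fml} : φ ∈ Γ → Prov E Γ φ
  | andI {Γ : List Fml} {φ ψ : Fml} : Prov E Γ φ → Prov E Γ ψ → Prov E Γ (φ.and ψ)
  | andE₁ {Γ : List Fml} {φ ψ : Fml} : Prov E Γ (φ.and ψ) → Prov E Γ φ
  | andE₂ {Γ : List Fml} {φ ψ : Fml} : Prov E Γ (φ.and ψ) → Prov E Γ ψ
  | orI₁ {Γ : List Fml} {φ ψ : Fml} : Prov E Γ φ → Prov E Γ (φ.or ψ)
  | orI₂ {Γ : List Fml} {φ ψ : Fml} : Prov E Γ ψ → Prov E Γ (φ.or ψ)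
  | orE {Γ : List Fml} {φ ψ χ : Fml} :
      Prov E Γ (φ.or ψ) → Prov E (φ :: Γ) χ → Prov E (ψ :: Γ) χ → Prov E Γ χ
  | impI {Γ : List Fml} {φ ψ : Fml} : Prov E (φ :: Γ) ψ → Prov E Γ (φ.imp ψ)
  | impE {Γ : List Fml} {φ ψ : Fml} : Prov E Γ (φ.imp ψ) → Prov E Γ φ → Prov E Γ ψ
  | allI {Γ : List Fml} {φ : Fml} : Prov E (Γ.map Fml.shift) φ → Prov E Γ φ.all
  | allE {Γ : List Fml} {φ : Fml} (t : Trm ℕ) : Prov E Γ φ.all → Prov E Γ (φ.inst t)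
  | exI {Γ : List Fml} {φ : Fml} (t : Trm ℕ) : Prov E Γ (φ.inst t) → Prov E Γ φ.ex
  | exE {Γ : List Fml} {φ χ : Fml} :
      Prov E Γ φ.ex → Prov E (φ :: Γ.map Fml.shift) χ.shift → Prov E Γ χ
  -- equality
  | eqRefl {Γ : List Fml} (t : Trm ℕ) : Prov E Γ (Fml.eq t t)
  | eqSubst {Γ : List Fml} {φ : Fml} {s t : Trm ℕ} :
      Prov E Γ (Fml.eq s t) → Prov E Γ (φ.inst s) → Prov E Γ (φ.inst t)
  -- the program, as a set of universally closed equations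
  | prog {Γ : List Fml} (e : Equation) (he : e ∈ E) (σ : ℕ → Trm ℕ) :
      Prov E Γ (Fml.eq (e.lhs.subst σ) (e.rhs.subst σ))
  -- injectiveness and separation of the constructors
  | inj {Γ : List Fml} (s t s' t' : Trm ℕ) :
      Prov E Γ ((Fml.eq (Trm.cons s t) (Trm.cons s' t')).imp ((Fml.eq s s').and (Fml.eq t t')))
  | sep {Γ : List Fml} {m n : ℕ} (c : Con m) (d : Con n)
      (hcd : (⟨m, c⟩ : Σ n, Con n) ≠ ⟨n, d⟩) (ts : Fin m → Trm ℕ) (us : Fin n → Trm ℕ) :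
      Prov E Γ ((Fml.eq (Trm.con c ts) (Trm.con d us)).imp Fml.bot)
  -- introduction and elimination (induction) for the booleans
  | bZero {Γ : List Fml} : Prov E Γ (Fml.B Trm.zero)
  | bOne {Γ : List Fml} : Prov E Γ (Fml.B Trm.one)
  | bInd {Γ : List Fml} {φ : Fml} {t : Trm ℕ} : Prov E Γ (Fml.B t) →
      Prov E Γ (φ.inst Trm.zero) → Prov E Γ (φ.inst Trm.one) → Prov E Γ (φ.inst t)
  -- elimination for streams: the two argument rules, and decomposition
  | sHd {Γ : List Fml} {s t : Trm ℕ} : Prov E Γ (Fml.S (Trm.cons s t)) → Prov E Γ (Fml.B s)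
  | sTl {Γ : List Fml} {s t : Trm ℕ} : Prov E Γ (Fml.S (Trm.cons s t)) → Prov E Γ (Fml.S t)
  | sDecomp {Γ : List Fml} {t : Trm ℕ} :
      Prov E Γ (Fml.S t) → Prov E Γ ((Fml.S (Trm.var 0)).dcm.inst t)
  -- introduction (coinduction) for streams
  | coind {Γ : List Fml} {φ : Fml} {t : Trm ℕ} : φ.StronglyPositive →
      Prov E Γ (φ.inst t) → Prov E (φ :: Γ.map Fml.shift) φ.dcm → Prov E Γ (Fml.S t)

/-- The formula `S(x₁) → ⋯ → S(xₖ) → S(f(x₁, …, xₖ))`. -/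
def productivity {k : ℕ} (f : PFn k) : Fml :=
  (List.ofFn fun i : Fin k => Fml.S (Trm.var (i : ℕ))).foldr Fml.imp
    (Fml.S (Trm.fn f fun i : Fin k => Trm.var (i : ℕ)))

/-- The program is provable in `IT⁺`: its productivity is derivable from its equations. -/
def Program.Provable {k : ℕ} (P : Program k) : Prop :=
  Prov P.eqs [] (productivity P.principal)

/-! ### Primitive corecursive functions -/

/-- The two data sorts: booleans and boolean streams. -/
inductive Srt : Type
  | B : Srt
  | S : Srt

/-- The canonical interpretation of a sort. -/
abbrev Srt.El : Srt → Type
  | Srt.B => Bool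
  | Srt.S => Stream' Bool

/-- `PrimCorec σ ρ f`: the function `f`, with arguments of sorts `σ 0, σ 1, …` and values of sort
`ρ`, is primitive corecursive, i.e. generated from the constructors, the destructors and the
discriminator by composition and (simultaneous) corecurrence. -/
inductive PrimCorec :
    {n : ℕ} → (σ : Fin n → Srt) → (ρ : Srt) → ((∀ i, (σ i).El) → ρ.El) → Prop
  | zero : PrimCorec ![] Srt.B (fun _ => false)
  | one : PrimCorec ![] Srt.B (fun _ => true)
  | cons : PrimCorec ![Srt.B, Srt.S] Srt.S (fun x => Stream'.cons (x 0) (x 1))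
  | hd : PrimCorec ![Srt.S] Srt.B (fun x => Stream'.head (x 0))
  | tl : PrimCorec ![Srt.S] Srt.S (fun x => Stream'.tail (x 0))
  /-- The discriminator at a boolean; at a stream it is a projection. -/
  | disc (ρ : Srt) : PrimCorec ![Srt.B, ρ, ρ] ρ
      (fun x => Bool.rec (motive := fun _ => ρ.El) (x 1) (x 2) (x 0))
  | proj {n : ℕ} (σ : Fin n → Srt) (i : Fin n) : PrimCorec σ (σ i) (fun x => x i)
  | comp {n m : ℕ} (σ : Fin n → Srt) (τ : Fin m → Srt) (ρ : Srt)
      (g : (∀ i, (τ i).El) → ρ.El) (h : ∀ i, (∀ j, (σ j).El) → (τ i).El) :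
      PrimCorec τ ρ g → (∀ i, PrimCorec σ (τ i) (h i)) →
      PrimCorec σ ρ (fun x => g fun i => h i x)
  | corec {n m : ℕ} (σ : Fin n → Srt)
      (h : Fin m → (∀ i, (σ i).El) → Bool) (l : Fin m → Fin m)
      (g : Fin m → ∀ i, (∀ i, (σ i).El) → (σ i).El)
      (f : Fin m → (∀ i, (σ i).El) → Stream' Bool) :
      (∀ j, PrimCorec σ Srt.B (h j)) → (∀ j i, PrimCorec σ (σ i) (g j i)) →
      (∀ j x, f j x = Stream'.cons (h j x) (f (l j) fun i => g j i x)) →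
      ∀ j, PrimCorec σ Srt.S (f j)

end BoolStream

/-!
Both directions go through `Unary`, the primitive corecursive functions of a single stream in which
corecurrence defines one function at a time. Interleaving packs any tuple of booleans and streams,
and the index of a simultaneous corecurrence as well, into one stream, so that a function is primitive
corecursive iff it is unary primitive corecursive in its packed arguments (`PrimCorec.unary`,
`Unary.primCorec`).

A provable program computes a primitive corecursive function because `IT⁺` is sound for a
realizability interpretation in functionals of finite type (`Prov.realized`). Individuals are the
terms modulo provable equality. A program that computes a function cannot prove all equations, and
then the equations for the destructors and the discriminator alone make the constructors injective and
separated in this structure, so no confluence argument is needed. A stream realizes `S(t)` if it gives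
the digits of `t` one destructor at a time, and quantifiers have no computational content. The Kripke
logical relation `Hered` over the unary primitive corecursive reparametrizations guarantees that all
realizers are primitive corecursive at ground type. This is where strong positivity matters: a
realizer of a strongly positive formula involves no functions and can be coded by a stream
(`Fml.StronglyPositive.exists_code`), hence the coiteration that realizes coinduction is a corecurrence
on streams (`realized_coind`). Applied to the productivity of the principal function, soundness yields
a unary primitive corecursive function whose values are the streams that the program proves
(`Program.Provable.exists_unary`).

Conversely, a program is built along the generation of a unary function (`Unary.exists_represents`),
together with an interpretation of its identifiers in the canonical structure. Corecurrence
`f(x) = h(x) : f(g(x))` becomes one new equation, and coinduction for `∃ x (p(x) ∧ z = f(x))` proves it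
productive on every strongly positive predicate `p` preserved by `g` (`Prov.stream_corec`). That the
program computes the function takes no evaluation of terms: realizability provides some stream as the
value, and validity of the program in the canonical structure shows that it is the right one
(`Program.Provable.computes`).
-/

namespace BoolStream

/-! ### Unary primitive corecursive functions -/

/-- Primitive corecursive functions of one stream argument, with corecurrence restricted to a single
function of a single stream. Interleaving is a generator because it serves as the pairing function
by which several arguments are packed into one. -/
inductive Unary : (ρ : Srt) → (Stream' Bool → ρ.El) → Prop
  | zero : Unary Srt.B fun _ => false
  | one : Unary Srt.B fun _ => true
  | cons {b : Stream' Bool → Bool} {s : Stream' Bool → Stream' Bool} :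
      Unary Srt.B b → Unary Srt.S s → Unary Srt.S fun x => Stream'.cons (b x) (s x)
  | hd {s : Stream' Bool → Stream' Bool} : Unary Srt.S s → Unary Srt.B fun x => (s x).head
  | tl {s : Stream' Bool → Stream' Bool} : Unary Srt.S s → Unary Srt.S fun x => (s x).tail
  | cond {ρ : Srt} {b : Stream' Bool → Bool} {f g : Stream' Bool → ρ.El} :
      Unary Srt.B b → Unary ρ f → Unary ρ g → Unary ρ fun x => cond (b x) (f x) (g x)
  | id : Unary Srt.S fun x => x
  | comp {ρ : Srt} {f : Stream' Bool → ρ.El} {g : Stream' Bool → Stream' Bool} :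
      Unary ρ f → Unary Srt.S g → Unary ρ fun x => f (g x)
  | interleave {f g : Stream' Bool → Stream' Bool} :
      Unary Srt.S f → Unary Srt.S g → Unary Srt.S fun x => (f x).interleave (g x)
  | corec {h : Stream' Bool → Bool} {g f : Stream' Bool → Stream' Bool} :
      Unary Srt.B h → Unary Srt.S g → (∀ x, f x = Stream'.cons (h x) (f (g x))) → Unary Srt.S f

theorem interleave_eq_cons (s t : Stream' Bool) :
    s.interleave t = Stream'.cons s.head (t.interleave s.tail) := by
  rw [← Stream'.eta (s.interleave t), Stream'.tail_interleave]
  rw [Stream'.interleave_eq]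
  rfl

theorem odd_interleave (s t : Stream' Bool) : (s.interleave t).odd = t := by
  rw [Stream'.odd_eq, Stream'.tail_interleave, Stream'.even_interleave]

section
variable {n : ℕ} {σ : Fin n → Srt}

theorem primCorec_false : PrimCorec σ Srt.B fun _ => false :=
  .comp σ ![] Srt.B _ (fun i => i.elim0) .zero fun i => i.elim0

theorem primCorec_true : PrimCorec σ Srt.B fun _ => true :=
  .comp σ ![] Srt.B _ (fun i => i.elim0) .one fun i => i.elim0

theorem PrimCorec.cons_comp {b : (∀ i, (σ i).El) → Bool} {s : (∀ i, (σ i).El) → Stream' Bool}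
    (hb : PrimCorec σ Srt.B b) (hs : PrimCorec σ Srt.S s) :
    PrimCorec σ Srt.S fun x => Stream'.cons (b x) (s x) :=
  .comp σ ![Srt.B, Srt.S] Srt.S _
    (fun i => match i with
      | 0 => b
      | 1 => s) .cons
    (fun i => match i with
      | 0 => hb
      | 1 => hs)

theorem PrimCorec.hd_comp {s : (∀ i, (σ i).El) → Stream' Bool} (hs : PrimCorec σ Srt.S s) :
    PrimCorec σ Srt.B fun x => (s x).head :=
  .comp σ ![Srt.S] Srt.B _ (fun i => match i with | 0 => s) .hd
    (fun i => match i with | 0 => hs)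

theorem PrimCorec.tl_comp {s : (∀ i, (σ i).El) → Stream' Bool} (hs : PrimCorec σ Srt.S s) :
    PrimCorec σ Srt.S fun x => (s x).tail :=
  .comp σ ![Srt.S] Srt.S _ (fun i => match i with | 0 => s) .tl
    (fun i => match i with | 0 => hs)

theorem PrimCorec.cond_comp {ρ : Srt} {b : (∀ i, (σ i).El) → Bool}
    {f g : (∀ i, (σ i).El) → ρ.El} (hb : PrimCorec σ Srt.B b) (hf : PrimCorec σ ρ f)
    (hg : PrimCorec σ ρ g) : PrimCorec σ ρ fun x => cond (b x) (f x) (g x) := by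
  have := PrimCorec.comp σ ![Srt.B, ρ, ρ] ρ _
    (fun i => match i with
      | 0 => b
      | 1 => g
      | 2 => f) (.disc ρ)
    (fun i => match i with
      | 0 => hb
      | 1 => hg
      | 2 => hf)
  convert this using 2 with x
  change _ = Bool.rec (motive := fun _ => ρ.El) (g x) (f x) (b x)
  cases b x <;> rfl

theorem PrimCorec.interleave_comp {f g : (∀ i, (σ i).El) → Stream' Bool}
    (hf : PrimCorec σ Srt.S f) (hg : PrimCorec σ Srt.S g) :
    PrimCorec σ Srt.S fun x => (f x).interleave (g x) := by
  let τ : Fin 2 → Srt := fun _ => Srt.S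
  have hz : PrimCorec τ Srt.S fun x => Stream'.interleave (x 0) (x 1) :=
    .corec (m := 1) τ (fun _ x => Stream'.head (x 0)) (fun _ => 0)
      (fun _ i => match i with
        | 0 => fun x => x 1
        | 1 => fun x => Stream'.tail (x 0))
      (fun _ x => Stream'.interleave (x 0) (x 1)) (fun _ => .hd_comp (.proj τ 0))
      (fun _ i => match i with
        | 0 => .proj τ 1
        | 1 => .tl_comp (.proj τ 0))
      (fun _ x => interleave_eq_cons _ _) 0
  exact .comp σ τ Srt.S _
    (fun i => match i with
      | 0 => f
      | 1 => g) hz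
    (fun i => match i with
      | 0 => hf
      | 1 => hg)

end

theorem Unary.primCorec {ρ : Srt} {f : Stream' Bool → ρ.El} (hf : Unary ρ f) :
    PrimCorec (fun _ : Fin 1 => Srt.S) ρ fun x => f (x 0) := by
  induction hf with
  | zero => exact primCorec_false
  | one => exact primCorec_true
  | cons _ _ hb hs => exact hb.cons_comp hs
  | hd _ hs => exact hs.hd_comp
  | tl _ hs => exact hs.tl_comp
  | cond _ _ _ hb hf hg => exact hb.cond_comp hf hg
  | id => exact .proj (fun _ : Fin 1 => Srt.S) 0
  | @comp ρ f g _ _ hf hg =>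
    exact .comp (fun _ : Fin 1 => Srt.S) (fun _ : Fin 1 => Srt.S) ρ (fun x => f (x 0))
      (fun _ x => g (x 0)) hf fun _ => hg
  | interleave _ _ hf hg => exact hf.interleave_comp hg
  | @corec h g f _ _ hf hh hg =>
    exact .corec (m := 1) (fun _ => Srt.S) (fun _ x => h (x 0)) (fun _ => 0) (fun _ _ x => g (x 0))
      (fun _ x => f (x 0)) (fun _ => hh) (fun _ _ => hg) (fun _ x => hf (x 0)) 0

theorem Unary.even {f : Stream' Bool → Stream' Bool} (hf : Unary Srt.S f) :
    Unary Srt.S fun x => (f x).even :=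
  .comp (f := Stream'.even)
    (.corec (h := Stream'.head) (g := fun x => x.tail.tail) (.hd .id) (.tl (.tl .id)) fun x => by
      rw [← Stream'.tail_even, ← Stream'.head_even, Stream'.eta]) hf

theorem Unary.odd {f : Stream' Bool → Stream' Bool} (hf : Unary Srt.S f) :
    Unary Srt.S fun x => (f x).odd :=
  hf.tl.even

theorem unary_const_false : Unary Srt.S fun _ => Stream'.const false :=
  .corec (h := fun _ => false) (g := fun x => x) .zero .id fun _ => Stream'.const_eq false

/-! ### Packing several arguments into one stream -/

/-- A boolean or a stream coded as a stream. -/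
def Srt.enc : (ρ : Srt) → ρ.El → Stream' Bool
  | Srt.B, b => Stream'.cons b (Stream'.const false)
  | Srt.S, s => s

/-- The inverse of `Srt.enc`. -/
def Srt.dec : (ρ : Srt) → Stream' Bool → ρ.El
  | Srt.B, s => s.head
  | Srt.S, s => s

theorem Srt.dec_enc (ρ : Srt) (v : ρ.El) : ρ.dec (ρ.enc v) = v := by
  cases ρ <;> rfl

theorem unary_enc {ρ : Srt} {f : Stream' Bool → ρ.El} (hf : Unary ρ f) :
    Unary Srt.S fun x => ρ.enc (f x) := by
  cases ρ with
  | B => exact .cons hf unary_const_false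
  | S => exact hf

theorem unary_dec (ρ : Srt) {f : Stream' Bool → Stream' Bool} (hf : Unary Srt.S f) :
    Unary ρ fun x => ρ.dec (f x) := by
  cases ρ with
  | B => exact .hd hf
  | S => exact hf

/-- Finitely many streams packed into one by iterated interleaving. -/
def pack : {n : ℕ} → (Fin n → Stream' Bool) → Stream' Bool
  | 0, _ => Stream'.const false
  | _ + 1, v => (v 0).interleave (pack fun i => v i.succ)

/-- The components of a packed tuple of streams. -/
def unpack : {n : ℕ} → Fin n → Stream' Bool → Stream' Bool
  | _ + 1, ⟨0, _⟩, s => s.even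
  | _ + 1, ⟨i + 1, h⟩, s => unpack ⟨i, Nat.lt_of_succ_lt_succ h⟩ s.odd

theorem unpack_pack {n : ℕ} (v : Fin n → Stream' Bool) (i : Fin n) : unpack i (pack v) = v i := by
  induction n with
  | zero => exact i.elim0
  | succ n ih =>
    refine Fin.cases ?_ (fun i => ?_) i
    · exact Stream'.even_interleave _ _
    · change unpack i (Stream'.odd _) = _
      rw [pack, odd_interleave, ih]

theorem unary_pack {n : ℕ} {v : Fin n → Stream' Bool → Stream' Bool} (hv : ∀ i, Unary Srt.S (v i)) :
    Unary Srt.S fun x => pack fun i => v i x := by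
  induction n with
  | zero => exact unary_const_false
  | succ n ih => exact .interleave (hv 0) (ih fun i => hv i.succ)

theorem unary_unpack {n : ℕ} (i : Fin n) {f : Stream' Bool → Stream' Bool} (hf : Unary Srt.S f) :
    Unary Srt.S fun x => unpack i (f x) := by
  induction n generalizing f with
  | zero => exact i.elim0
  | succ n ih =>
    refine Fin.cases ?_ (fun i => ?_) i
    · exact hf.even
    · exact ih i hf.odd

/-- The tuple of arguments of sorts `σ` coded by a stream. -/
def decArgs {n : ℕ} (σ : Fin n → Srt) (s : Stream' Bool) (i : Fin n) : (σ i).El :=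
  (σ i).dec (unpack i s)

/-- A code of a tuple of arguments of sorts `σ`. -/
def encArgs {n : ℕ} (σ : Fin n → Srt) (v : ∀ i, (σ i).El) : Stream' Bool :=
  pack fun i => (σ i).enc (v i)

theorem decArgs_encArgs {n : ℕ} (σ : Fin n → Srt) (v : ∀ i, (σ i).El) :
    decArgs σ (encArgs σ v) = v := by
  funext i
  rw [decArgs, encArgs, unpack_pack, Srt.dec_enc]

/-- The index in `Fin (m + 1)` coded in unary by the beginning of a stream. -/
def decIdx : (m : ℕ) → Stream' Bool → Fin (m + 1)
  | 0, _ => 0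
  | m + 1, s => cond s.head 0 (decIdx m s.tail).succ

theorem exists_unary_decIdx_eq (m : ℕ) (j : Fin (m + 1)) :
    ∃ c : Stream' Bool, Unary Srt.S (fun _ => c) ∧ decIdx m c = j := by
  induction m with
  | zero => exact ⟨_, unary_const_false, (Subsingleton.elim (α := Fin 1) _ _)⟩
  | succ m ih =>
    refine Fin.cases ?_ (fun j => ?_) j
    · exact ⟨_, .cons .one unary_const_false, rfl⟩
    · obtain ⟨c, hc, hj⟩ := ih j
      exact ⟨_, .cons .zero hc, congrArg Fin.succ hj⟩

theorem Unary.finCases {ρ : Srt} (m : ℕ) {f : Fin (m + 1) → Stream' Bool → ρ.El}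
    {c : Stream' Bool → Stream' Bool} (hc : Unary Srt.S c) (hf : ∀ j, Unary ρ (f j)) :
    Unary ρ fun x => f (decIdx m (c x)) x := by
  induction m generalizing c with
  | zero => exact hf 0
  | succ m ih =>
    have := Unary.cond hc.hd (hf 0) (ih hc.tl fun j => hf j.succ)
    convert this using 2 with x
    simp only [decIdx]
    cases (c x).head <;> rfl

/-- Every primitive corecursive function becomes unary when its arguments are packed into one
stream. In simultaneous corecurrence the index of the current function is packed as well. -/
theorem PrimCorec.unary {n : ℕ} {σ : Fin n → Srt} {ρ : Srt} {f : (∀ i, (σ i).El) → ρ.El}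
    (hf : PrimCorec σ ρ f) : Unary ρ fun x => f (decArgs σ x) := by
  have arg {n : ℕ} (σ : Fin n → Srt) (i : Fin n) : Unary (σ i) fun x => decArgs σ x i :=
    unary_dec _ (unary_unpack i .id)
  have enc {n : ℕ} (σ : Fin n → Srt) (v : ∀ i, Stream' Bool → (σ i).El)
      (hv : ∀ i, Unary (σ i) (v i)) : Unary Srt.S fun x => encArgs σ fun i => v i x :=
    unary_pack fun i => unary_enc (hv i)
  induction hf with
  | zero => exact .zero
  | one => exact .one
  | cons => exact .cons (arg ![Srt.B, Srt.S] 0) (arg ![Srt.B, Srt.S] 1)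
  | hd => exact .hd (arg ![Srt.S] 0)
  | tl => exact .tl (arg ![Srt.S] 0)
  | disc ρ =>
    have := Unary.cond (ρ := ρ) (arg ![Srt.B, ρ, ρ] 0) (arg ![Srt.B, ρ, ρ] 2)
      (arg ![Srt.B, ρ, ρ] 1)
    convert this using 2 with x
    change Bool.rec (motive := fun _ => ρ.El) _ _ (decArgs ![Srt.B, ρ, ρ] x 0) = _
    cases decArgs ![Srt.B, ρ, ρ] x 0 <;> rfl
  | proj σ i => exact arg σ i
  | comp σ τ ρ g h _ _ ihg ihh =>
    have := Unary.comp ihg (enc τ _ ihh)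
    simpa only [decArgs_encArgs] using this
  | @corec n m σ h l g f _ _ hf j ihh ihg =>
    obtain _ | m := m
    · exact j.elim0
    choose c hc hcj using exists_unary_decIdx_eq m
    have odd {ρ : Srt} {u : Stream' Bool → ρ.El} (hu : Unary ρ u) : Unary ρ fun x => u x.odd :=
      hu.comp (.odd .id)
    have key : Unary Srt.S fun x => f (decIdx m x.even) (decArgs σ x.odd) := by
      refine .corec (h := fun x => h (decIdx m x.even) (decArgs σ x.odd))
        (g := fun x => (c (l (decIdx m x.even))).interleave
          (encArgs σ fun i => g (decIdx m x.even) i (decArgs σ x.odd)))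
        (.finCases m (.even .id) fun j => odd (ihh j))
        (.interleave
          (Unary.finCases (ρ := Srt.S) m (f := fun j _ => c (l j)) (.even .id) fun j => hc (l j))
          (Unary.finCases (ρ := Srt.S) m (f := fun j x => encArgs σ fun i => g j i (decArgs σ x.odd))
            (.even .id) fun j => enc σ _ fun i => odd (ihg j i)))
        fun x => ?_
      rw [hf, Stream'.even_interleave, odd_interleave, decArgs_encArgs, hcj]
    have := key.comp (.interleave (hc j) .id)
    simpa only [Stream'.even_interleave, odd_interleave, hcj] using this

theorem Unary.primCorec_comp {n : ℕ} {σ : Fin n → Srt} {r : Stream' Bool → Stream' Bool}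
    (hr : Unary Srt.S r) {f : (∀ i, (σ i).El) → Stream' Bool} (hf : PrimCorec σ Srt.S f) :
    PrimCorec σ Srt.S fun x => r (f x) :=
  .comp σ (fun _ : Fin 1 => Srt.S) Srt.S (fun x => r (x 0)) (fun _ x => f x) hr.primCorec
    fun _ => hf

theorem primCorec_pack {n m : ℕ} {σ : Fin n → Srt} {f : Fin m → (∀ i, (σ i).El) → Stream' Bool}
    (hf : ∀ i, PrimCorec σ Srt.S (f i)) : PrimCorec σ Srt.S fun x => pack fun i => f i x := by
  induction m with
  | zero =>
    exact .corec (m := 1) σ (fun _ _ => false) (fun _ => 0) (fun _ i x => x i)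
      (fun _ _ => Stream'.const false) (fun _ => primCorec_false) (fun _ => .proj σ)
      (fun _ _ => Stream'.const_eq false) 0
  | succ m ih => exact .interleave_comp (hf 0) (ih fun i => hf i.succ)


/-! ### Substitution -/

namespace Trm
variable {α β γ : Type}

@[simp] theorem subst_var (a : α) (σ : α → Trm β) :
    Language.Term.subst (Trm.var a) σ = σ a := rfl

@[simp] theorem subst_zero (σ : α → Trm β) : Language.Term.subst Trm.zero σ = Trm.zero :=
  congrArg (Language.Term.func _) (funext fun i => by fin_cases i)

@[simp] theorem subst_one (σ : α → Trm β) : Language.Term.subst Trm.one σ = Trm.one :=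
  congrArg (Language.Term.func _) (funext fun i => by fin_cases i)

@[simp] theorem subst_cons (s t : Trm α) (σ : α → Trm β) :
    Language.Term.subst (Trm.cons s t) σ = Trm.cons (s.subst σ) (t.subst σ) :=
  congrArg (Language.Term.func _) (funext fun i => by fin_cases i <;> rfl)

@[simp] theorem subst_hd (t : Trm α) (σ : α → Trm β) :
    Language.Term.subst (Trm.hd t) σ = Trm.hd (t.subst σ) :=
  congrArg (Language.Term.func _) (funext fun i => by fin_cases i; rfl)

@[simp] theorem subst_tl (t : Trm α) (σ : α → Trm β) :
    Language.Term.subst (Trm.tl t) σ = Trm.tl (t.subst σ) :=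
  congrArg (Language.Term.func _) (funext fun i => by fin_cases i; rfl)

@[simp] theorem subst_disc (t x y z : Trm α) (σ : α → Trm β) :
    Language.Term.subst (Trm.disc t x y z) σ =
      Trm.disc (t.subst σ) (x.subst σ) (y.subst σ) (z.subst σ) :=
  congrArg (Language.Term.func _) (funext fun i => by fin_cases i <;> rfl)

theorem con_eq_zero (ts : Fin 0 → Trm α) : Trm.con Con.zero ts = Trm.zero :=
  congrArg (Language.Term.func _) (funext fun i => i.elim0)

theorem con_eq_one (ts : Fin 0 → Trm α) : Trm.con Con.one ts = Trm.one :=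
  congrArg (Language.Term.func _) (funext fun i => i.elim0)

theorem con_eq_cons (ts : Fin 2 → Trm α) :
    Trm.con Con.cons ts = Trm.cons (ts 0) (ts 1) :=
  congrArg (Language.Term.func _) (funext fun i => by fin_cases i <;> rfl)

theorem subst_subst (t : Trm α) (σ : α → Trm β) (τ : β → Trm γ) :
    Language.Term.subst (Language.Term.subst t σ) τ = t.subst fun a => (σ a).subst τ := by
  induction t with
  | var a => rfl
  | func f ts ih => exact congrArg _ (funext ih)

end Trm

/-! ### Equational derivability -/

namespace EqDeriv
variable {E : Set Equation}

theorem subst_congr {η θ : ℕ → DTrm} (h : ∀ n, EqDeriv E (η n) (θ n)) (t : Trm ℕ) :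
    EqDeriv E (t.subst η) (t.subst θ) := by
  induction t with
  | var n => exact h n
  | func f ts ih => exact .congr f _ _ ih

theorem cons_congr {s t s' t' : DTrm} (hs : EqDeriv E s s') (ht : EqDeriv E t t') :
    EqDeriv E (Trm.cons s t) (Trm.cons s' t') :=
  .congr _ _ _ fun i => match i with
    | 0 => hs
    | 1 => ht

theorem hd_congr {t t' : DTrm} (ht : EqDeriv E t t') : EqDeriv E (Trm.hd t) (Trm.hd t') :=
  .congr _ _ _ fun i => match i with | 0 => ht

theorem tl_congr {t t' : DTrm} (ht : EqDeriv E t t') : EqDeriv E (Trm.tl t) (Trm.tl t') :=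
  .congr _ _ _ fun i => match i with | 0 => ht

theorem disc_congr {t t' : DTrm} (ht : EqDeriv E t t') (x y z : DTrm) :
    EqDeriv E (Trm.disc t x y z) (Trm.disc t' x y z) :=
  .congr _ _ _ fun i => match i with
    | 0 => ht
    | 1 => .refl _
    | 2 => .refl _
    | 3 => .refl _

theorem hd_cons (hE : stdEqs ⊆ E) (s t : DTrm) : EqDeriv E (Trm.hd (Trm.cons s t)) s := by
  have := EqDeriv.prog (E := E) ⟨1, PFn.hd, ![Trm.cons (Trm.var 0) (Trm.var 1)], Trm.var 0⟩
    (hE (by simp [stdEqs])) fun n => if n = 0 then s else t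
  change EqDeriv E (Language.Term.subst (Trm.hd _) _) _ at this
  simpa using this

theorem tl_cons (hE : stdEqs ⊆ E) (s t : DTrm) : EqDeriv E (Trm.tl (Trm.cons s t)) t := by
  have := EqDeriv.prog (E := E) ⟨1, PFn.tl, ![Trm.cons (Trm.var 0) (Trm.var 1)], Trm.var 1⟩
    (hE (by simp [stdEqs])) fun n => if n = 0 then s else t
  change EqDeriv E (Language.Term.subst (Trm.tl _) _) _ at this
  simpa using this

theorem disc_zero (hE : stdEqs ⊆ E) (x y z : DTrm) : EqDeriv E (Trm.disc Trm.zero x y z) x := by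
  have := EqDeriv.prog (E := E)
    ⟨4, PFn.disc, ![Trm.zero, Trm.var 0, Trm.var 1, Trm.var 2], Trm.var 0⟩
    (hE (by simp [stdEqs])) fun n => if n = 0 then x else if n = 1 then y else z
  change EqDeriv E (Language.Term.subst (Trm.disc _ _ _ _) _) _ at this
  simpa using this

theorem disc_one (hE : stdEqs ⊆ E) (x y z : DTrm) : EqDeriv E (Trm.disc Trm.one x y z) y := by
  have := EqDeriv.prog (E := E)
    ⟨4, PFn.disc, ![Trm.one, Trm.var 0, Trm.var 1, Trm.var 2], Trm.var 1⟩
    (hE (by simp [stdEqs])) fun n => if n = 0 then x else if n = 1 then y else z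
  change EqDeriv E (Language.Term.subst (Trm.disc _ _ _ _) _) _ at this
  simpa using this

theorem disc_cons (hE : stdEqs ⊆ E) (s t x y z : DTrm) :
    EqDeriv E (Trm.disc (Trm.cons s t) x y z) z := by
  have := EqDeriv.prog (E := E)
    ⟨4, PFn.disc, ![Trm.cons (Trm.var 3) (Trm.var 4), Trm.var 0, Trm.var 1, Trm.var 2],
      Trm.var 2⟩
    (hE (by simp [stdEqs])) fun n => if n = 0 then x else if n = 1 then y else if n = 2 then z
      else if n = 3 then s else t
  change EqDeriv E (Language.Term.subst (Trm.disc _ _ _ _) _) _ at this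
  simpa using this

theorem cons_inj (hE : stdEqs ⊆ E) {s t s' t' : DTrm}
    (h : EqDeriv E (Trm.cons s t) (Trm.cons s' t')) : EqDeriv E s s' ∧ EqDeriv E t t' :=
  ⟨(hd_cons hE s t).symm.trans (h.hd_congr.trans (hd_cons hE s' t')),
    (tl_cons hE s t).symm.trans (h.tl_congr.trans (tl_cons hE s' t'))⟩

/-- The discriminator separates the constructors in every consistent program: an equation between
terms with distinct main constructors makes all terms equal. -/
theorem con_ne_con (hE : stdEqs ⊆ E) {m n : ℕ} (c : Con m) (d : Con n)
    (hcd : (⟨m, c⟩ : Σ n, Con n) ≠ ⟨n, d⟩) (ts : Fin m → DTrm) (us : Fin n → DTrm)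
    (h : EqDeriv E (Trm.con c ts) (Trm.con d us)) (s t : DTrm) : EqDeriv E s t := by
  have key (x y z : DTrm) := disc_congr h x y z
  cases c <;> cases d <;> simp only [Trm.con_eq_zero, Trm.con_eq_one, Trm.con_eq_cons] at key <;>
    first
    | exact absurd rfl hcd
    | exact (disc_zero hE _ _ _).symm.trans ((key s t t).trans (disc_one hE _ _ _))
    | exact (disc_zero hE _ _ _).symm.trans ((key s t t).trans (disc_cons hE _ _ _ _ _))
    | exact (disc_one hE _ _ _).symm.trans ((key t s t).trans (disc_zero hE _ _ _))
    | exact (disc_one hE _ _ _).symm.trans ((key t s t).trans (disc_cons hE _ _ _ _ _))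
    | exact (disc_cons hE _ _ _ _ _).symm.trans ((key t t s).trans (disc_zero hE _ _ _))
    | exact (disc_cons hE _ _ _ _ _).symm.trans ((key t t s).trans (disc_one hE _ _ _))

end EqDeriv

/-! ### Types of realizers -/

/-- The simple types over booleans and streams. -/
inductive Ty : Type
  | base (ρ : Srt) : Ty
  | unit : Ty
  | prod (T U : Ty) : Ty
  | arr (T U : Ty) : Ty

/-- The full set-theoretic hierarchy of functionals. -/
def Ty.El : Ty → Type
  | base ρ => ρ.El
  | unit => Unit
  | prod T U => T.El × U.El
  | arr T U => T.El → U.El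

/-- The Kripke logical relation that singles out the families of functionals, parametrized by a
stream, which preserve primitive corecursiveness hereditarily. Worlds are related by unary primitive
corecursive reparametrizations. -/
def Hered : (T : Ty) → (Stream' Bool → T.El) → Prop
  | Ty.base ρ, f => Unary ρ f
  | Ty.unit, _ => True
  | Ty.prod T U, f => Hered T (fun x => (f x).1) ∧ Hered U fun x => (f x).2
  | Ty.arr T U, f => ∀ g, Unary Srt.S g → ∀ a, Hered T a → Hered U fun x => f (g x) (a x)

theorem Hered.comp {T : Ty} {f : Stream' Bool → T.El} (hf : Hered T f)
    {g : Stream' Bool → Stream' Bool} (hg : Unary Srt.S g) : Hered T fun x => f (g x) := by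
  induction T with
  | base ρ => exact Unary.comp hf hg
  | unit => trivial
  | prod T U ihT ihU => exact ⟨ihT hf.1, ihU hf.2⟩
  | arr T U _ _ => exact fun k hk a ha => hf _ (hg.comp hk) a ha

/-- Definition by cases on a boolean lifts to all types. -/
theorem Hered.cond {T : Ty} {b : Stream' Bool → Bool} (hb : Unary Srt.B b)
    {f g : Stream' Bool → T.El} (hf : Hered T f) (hg : Hered T g) :
    Hered T fun x => cond (b x) (f x) (g x) := by
  induction T generalizing b with
  | base ρ => exact Unary.cond hb hf hg
  | unit => trivial
  | prod T U ihT ihU =>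
    refine ⟨?_, ?_⟩
    · convert ihT hb hf.1 hg.1 using 2 with x
      change Prod.fst (_root_.cond (b x) (f x) (g x)) = _
      cases b x <;> rfl
    · convert ihU hb hf.2 hg.2 using 2 with x
      change Prod.snd (_root_.cond (b x) (f x) (g x)) = _
      cases b x <;> rfl
  | arr T U _ ihU =>
    intro k hk a ha
    convert ihU (hb.comp hk) (hf k hk a ha) (hg k hk a ha) using 2 with x
    change (_root_.cond (b (k x)) (f (k x)) (g (k x)) : T.El → U.El) (a x) = _
    cases b (k x) <;> rfl

/-- Every type is inhabited by a hereditarily primitive corecursive functional. It fills the unused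
component of a realizer of a disjunction. -/
theorem exists_hered_const (T : Ty) : ∃ d : T.El, Hered T fun _ => d := by
  induction T with
  | base ρ => cases ρ with
    | B => exact ⟨false, Unary.zero⟩
    | S => exact ⟨_, unary_const_false⟩
  | unit => exact ⟨(), trivial⟩
  | prod T U ihT ihU =>
    obtain ⟨d, hd⟩ := ihT
    obtain ⟨e, he⟩ := ihU
    exact ⟨(d, e), hd, he⟩
  | arr T U _ ihU =>
    obtain ⟨e, he⟩ := ihU
    exact ⟨fun _ => e, fun _ _ _ _ => he⟩

/-- The type of realizers of a formula. Quantifiers and equations have no computational content, and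
a disjunction is realized by a boolean together with a realizer for each disjunct, of which only the
one selected by the boolean (`false` for the left) matters. -/
def Fml.ty : Fml → Ty
  | B _ => Ty.base Srt.B
  | S _ => Ty.base Srt.S
  | eq _ _ => Ty.unit
  | bot => Ty.unit
  | and φ ψ => Ty.prod φ.ty ψ.ty
  | or φ ψ => Ty.prod (Ty.base Srt.B) (Ty.prod φ.ty ψ.ty)
  | imp φ ψ => Ty.arr φ.ty ψ.ty
  | all φ => φ.ty
  | ex φ => φ.ty

theorem Fml.ty_subst (φ : Fml) (σ : ℕ → Trm ℕ) : (φ.subst σ).ty = φ.ty := by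
  induction φ generalizing σ <;> simp [Fml.subst, Fml.ty, *]

theorem Fml.ty_inst (φ : Fml) (t : Trm ℕ) : (φ.inst t).ty = φ.ty := φ.ty_subst _

theorem Fml.ty_shift (φ : Fml) : φ.shift.ty = φ.ty := φ.ty_subst _

/-- The realizers of a strongly positive formula can be coded by streams, since its type contains no
arrow. -/
theorem Fml.StronglyPositive.exists_code {φ : Fml} (hφ : φ.StronglyPositive) :
    ∃ (enc : φ.ty.El → Stream' Bool) (dec : Stream' Bool → φ.ty.El), (∀ v, dec (enc v) = v) ∧
      (∀ a, Hered φ.ty a → Unary Srt.S fun x => enc (a x)) ∧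
      ∀ f, Unary Srt.S f → Hered φ.ty fun x => dec (f x) := by
  induction hφ with
  | B t => exact ⟨Srt.B.enc, Srt.B.dec, Srt.B.dec_enc, fun a ha => unary_enc ha,
      fun f hf => unary_dec Srt.B hf⟩
  | S t => exact ⟨id, id, fun _ => rfl, fun a ha => ha, fun f hf => hf⟩
  | eq s t => exact ⟨fun _ => Stream'.const false, fun _ => (), fun _ => rfl,
      fun _ _ => unary_const_false, fun _ _ => trivial⟩
  | and _ _ ih₁ ih₂ =>
    obtain ⟨e₁, d₁, h₁, he₁, hd₁⟩ := ih₁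
    obtain ⟨e₂, d₂, h₂, he₂, hd₂⟩ := ih₂
    refine ⟨fun v => (e₁ v.1).interleave (e₂ v.2), fun s => (d₁ s.even, d₂ s.odd),
      fun v => ?_, fun a ha => (he₁ _ ha.1).interleave (he₂ _ ha.2),
      fun f hf => ⟨hd₁ _ hf.even, hd₂ _ hf.odd⟩⟩
    exact Prod.ext ((congrArg d₁ (Stream'.even_interleave _ _)).trans (h₁ _))
      ((congrArg d₂ (odd_interleave _ _)).trans (h₂ _))
  | or _ _ ih₁ ih₂ =>
    obtain ⟨e₁, d₁, h₁, he₁, hd₁⟩ := ih₁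
    obtain ⟨e₂, d₂, h₂, he₂, hd₂⟩ := ih₂
    refine ⟨fun v => Stream'.cons v.1 ((e₁ v.2.1).interleave (e₂ v.2.2)),
      fun s => (s.head, d₁ s.tail.even, d₂ s.tail.odd),
      fun v => ?_, fun a ha => .cons ha.1 ((he₁ _ ha.2.1).interleave (he₂ _ ha.2.2)),
      fun f hf => ⟨hf.hd, hd₁ _ hf.tl.even, hd₂ _ hf.tl.odd⟩⟩
    exact Prod.ext rfl (Prod.ext ((congrArg d₁ (Stream'.even_interleave _ _)).trans (h₁ _))
      ((congrArg d₂ (odd_interleave _ _)).trans (h₂ _)))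
  | ex _ ih => exact ih

/-! ### Realizability -/

/-- The numeral of a boolean. -/
def boolTrm {α : Type} : Bool → Trm α
  | false => Trm.zero
  | true => Trm.one

/-- The term `m` is provably equal to `s₀ : s₁ : ⋯`, one destructor at a time. -/
def StreamEq (E : Set Equation) (m : DTrm) (s : Stream' Bool) : Prop :=
  ∀ n, EqDeriv E (Trm.tl^[n] m) (Trm.cons (boolTrm (s.get n)) (Trm.tl^[n + 1] m))

/-- An assignment extended by a value for the variable `0`. -/
def extend (m : DTrm) (η : ℕ → DTrm) : ℕ → DTrm
  | 0 => m
  | n + 1 => η n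

/-- `Real E φ η T r`: the functional `r` realizes `φ` under the assignment `η`, in the structure of
terms modulo provable equality. The type `T` is a parameter rather than `φ.ty`, so that realizers of
`φ` and of its substitution instances need not be transported along equations between types. -/
def Real (E : Set Equation) : Fml → (ℕ → DTrm) → (T : Ty) → T.El → Prop
  | Fml.B t, η, Ty.base Srt.B, b => EqDeriv E (t.subst η) (boolTrm b)
  | Fml.S t, η, Ty.base Srt.S, s => StreamEq E (t.subst η) s
  | Fml.eq s t, η, Ty.unit, _ => EqDeriv E (s.subst η) (t.subst η)
  | Fml.and φ ψ, η, Ty.prod T U, r => Real E φ η T r.1 ∧ Real E ψ η U r.2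
  | Fml.or φ ψ, η, Ty.prod (Ty.base Srt.B) (Ty.prod T U), r =>
    (r.1 = false ∧ Real E φ η T r.2.1) ∨ (r.1 = true ∧ Real E ψ η U r.2.2)
  | Fml.imp φ ψ, η, Ty.arr T U, r => ∀ a, Real E φ η T a → Real E ψ η U (r a)
  | Fml.all φ, η, T, r => ∀ m, Real E φ (extend m η) T r
  | Fml.ex φ, η, T, r => ∃ m, Real E φ (extend m η) T r
  | _, _, _, _ => False


theorem EqDeriv.tl_iterate_congr {E : Set Equation} {m m' : DTrm} (h : EqDeriv E m m') (n : ℕ) :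
    EqDeriv E (Trm.tl^[n] m) (Trm.tl^[n] m') := by
  induction n with
  | zero => exact h
  | succ n ih =>
    rw [Function.iterate_succ_apply', Function.iterate_succ_apply']
    exact ih.tl_congr

theorem StreamEq.congr {E : Set Equation} {m m' : DTrm} {s : Stream' Bool} (h : EqDeriv E m m')
    (hm : StreamEq E m s) : StreamEq E m' s := fun n =>
  (h.tl_iterate_congr n).symm.trans
    ((hm n).trans (.cons_congr (.refl _) (h.tl_iterate_congr (n + 1))))

theorem StreamEq.eq_cons {E : Set Equation} {m : DTrm} {s : Stream' Bool} (hm : StreamEq E m s) :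
    EqDeriv E m (Trm.cons (boolTrm s.head) (Trm.tl m)) := hm 0

theorem StreamEq.tail {E : Set Equation} {m : DTrm} {s : Stream' Bool} (hm : StreamEq E m s) :
    StreamEq E (Trm.tl m) s.tail := fun n => hm (n + 1)

theorem StreamEq.coind {E : Set Equation} (hE : stdEqs ⊆ E) (R : DTrm → Stream' Bool → Prop)
    (hR : ∀ m s, R m s → ∃ m', EqDeriv E m (Trm.cons (boolTrm s.head) m') ∧ R m' s.tail)
    {m : DTrm} {s : Stream' Bool} (h : R m s) : StreamEq E m s := by
  intro n
  induction n generalizing m s with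
  | zero =>
    obtain ⟨m', hm, -⟩ := hR m s h
    exact hm.trans (.cons_congr (.refl _) (hm.tl_congr.trans (.tl_cons hE _ _)).symm)
  | succ n ih =>
    obtain ⟨m', hm, h'⟩ := hR m s h
    have htl : EqDeriv E (Trm.tl m) m' := hm.tl_congr.trans (.tl_cons hE _ _)
    exact (htl.tl_iterate_congr n).trans
      ((ih h').trans (.cons_congr (.refl _) (htl.tl_iterate_congr (n + 1)).symm))

theorem Real.congr {E : Set Equation} {φ : Fml} {η θ : ℕ → DTrm} (h : ∀ n, EqDeriv E (η n) (θ n))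
    {T : Ty} {r : T.El} (hr : Real E φ η T r) : Real E φ θ T r := by
  have ext {η θ : ℕ → DTrm} (h : ∀ n, EqDeriv E (η n) (θ n)) (m : DTrm) :
      ∀ n, EqDeriv E (extend m η n) (extend m θ n)
    | 0 => .refl m
    | n + 1 => h n
  -- both assignments are generalized: at an implication the two of them exchange their roles
  suffices ∀ η θ : ℕ → DTrm, (∀ n, EqDeriv E (η n) (θ n)) → ∀ T r,
      Real E φ η T r → Real E φ θ T r from this η θ h T r hr
  clear h hr
  induction φ with
  | B t =>
    rintro η θ h (_ | _ | _) r hr <;> rename_i ρ <;> try exact hr.elim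
    cases ρ
    · exact (EqDeriv.subst_congr h t).symm.trans hr
    · exact hr.elim
  | S t =>
    rintro η θ h (_ | _ | _) r hr <;> rename_i ρ <;> try exact hr.elim
    cases ρ
    · exact hr.elim
    · exact StreamEq.congr (EqDeriv.subst_congr h t) hr
  | eq s t =>
    rintro η θ h (_ | _ | _) r hr <;> try exact hr.elim
    exact (EqDeriv.subst_congr h s).symm.trans (EqDeriv.trans hr (EqDeriv.subst_congr h t))
  | bot => exact fun η θ h T r hr => hr.elim
  | and φ ψ ih₁ ih₂ =>
    rintro η θ h (_ | _ | _) r hr <;> try exact hr.elim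
    exact ⟨ih₁ η θ h _ _ hr.1, ih₂ η θ h _ _ hr.2⟩
  | or φ ψ ih₁ ih₂ =>
    rintro η θ h (_ | _ | ⟨(⟨_ | _⟩ | _), (_ | _)⟩) r hr <;> try exact hr.elim
    exact hr.imp (fun hr => ⟨hr.1, ih₁ η θ h _ _ hr.2⟩) fun hr => ⟨hr.1, ih₂ η θ h _ _ hr.2⟩
  | imp φ ψ ih₁ ih₂ =>
    rintro η θ h (_ | _ | _) r hr <;> try exact hr.elim
    exact fun a ha => ih₂ η θ h _ _ (hr a (ih₁ θ η (fun n => (h n).symm) _ _ ha))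
  | all φ ih => exact fun η θ h T r hr m => ih _ _ (ext h m) T r (hr m)
  | ex φ ih =>
    rintro η θ h T r ⟨m, hr⟩
    exact ⟨m, ih _ _ (ext h m) T r hr⟩

theorem real_subst {E : Set Equation} (φ : Fml) (σ : ℕ → Trm ℕ) (η : ℕ → DTrm) (T : Ty)
    (r : T.El) : Real E (φ.subst σ) η T r ↔ Real E φ (fun n => (σ n).subst η) T r := by
  have lift (σ : ℕ → Trm ℕ) (η : ℕ → DTrm) (m : DTrm) :
      (fun n => (liftSubst σ n).subst (extend m η)) = extend m fun n => (σ n).subst η := by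
    funext n
    cases n with
    | zero => rfl
    | succ n => exact Trm.subst_subst _ _ _
  induction φ generalizing σ η T with
  | B t => rcases T with ⟨_ | _⟩ | _ | _ | _ <;> simp [Real, Fml.subst, Trm.subst_subst]
  | S t => rcases T with ⟨_ | _⟩ | _ | _ | _ <;> simp [Real, Fml.subst, Trm.subst_subst]
  | eq s t => rcases T with ⟨_ | _⟩ | _ | _ | _ <;> simp [Real, Fml.subst, Trm.subst_subst]
  | bot => exact Iff.rfl
  | and φ ψ ih₁ ih₂ => rcases T with _ | _ | _ | _ <;> simp [Real, Fml.subst, ih₁, ih₂]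
  | or φ ψ ih₁ ih₂ =>
    rcases T with _ | _ | ⟨(⟨_ | _⟩ | _), (_ | _)⟩ | _ <;> simp [Real, Fml.subst, ih₁, ih₂]
  | imp φ ψ ih₁ ih₂ => rcases T with _ | _ | _ | _ <;> simp [Real, Fml.subst, ih₁, ih₂]
  | all φ ih => simp only [Real, Fml.subst, ih, lift]
  | ex φ ih => simp only [Real, Fml.subst, ih, lift]

theorem real_shift {E : Set Equation} (φ : Fml) (η : ℕ → DTrm) (m : DTrm) (T : Ty) (r : T.El) :
    Real E φ.shift (extend m η) T r ↔ Real E φ η T r := real_subst _ _ _ _ _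

theorem real_inst {E : Set Equation} (φ : Fml) (t : Trm ℕ) (η : ℕ → DTrm) (T : Ty) (r : T.El) :
    Real E (φ.inst t) η T r ↔ Real E φ (extend (t.subst η) η) T r := by
  rw [Fml.inst, real_subst]
  exact iff_of_eq (congrArg (Real E φ · T r) (funext fun n => by cases n <;> rfl))

theorem Fml.ty_dcm (φ : Fml) :
    φ.dcm.ty = Ty.prod (Ty.base Srt.B) (Ty.prod φ.ty Ty.unit) := by
  simp [Fml.dcm, Fml.ty, Fml.ty_subst]

theorem real_dcm {E : Set Equation} (φ : Fml) (m : DTrm) (η : ℕ → DTrm) (T : Ty)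
    (r : Bool × T.El × Unit) :
    Real E φ.dcm (extend m η) (Ty.prod (Ty.base Srt.B) (Ty.prod T Ty.unit)) r ↔
      ∃ z₀ z₁, EqDeriv E z₀ (boolTrm r.1) ∧ Real E φ (extend z₁ η) T r.2.1 ∧
        EqDeriv E m (Trm.cons z₀ z₁) := by
  simp only [Fml.dcm, Real, real_subst]
  refine exists_congr fun z₀ => exists_congr fun z₁ => and_congr Iff.rfl (and_congr ?_ ?_)
  · exact iff_of_eq (congrArg (Real E φ · T r.2.1) (funext fun n => by cases n <;> rfl))
  · rw [Trm.subst_cons]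
    exact Iff.rfl

/-- The conjunction of the open assumptions. -/
def conj : List Fml → Fml
  | [] => Fml.eq (Trm.var 0) (Trm.var 0)
  | φ :: Γ => φ.and (conj Γ)

theorem conj_shift_ty (Γ : List Fml) : (conj (Γ.map Fml.shift)).ty = (conj Γ).ty := by
  induction Γ with
  | nil => rfl
  | cons φ Γ ih => exact congrArg₂ Ty.prod φ.ty_shift ih

theorem real_conj_shift {E : Set Equation} (Γ : List Fml) (η : ℕ → DTrm) (m : DTrm) (T : Ty)
    (r : T.El) : Real E (conj Γ) η T r → Real E (conj (Γ.map Fml.shift)) (extend m η) T r := by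
  induction Γ generalizing T with
  | nil =>
    rcases T with ⟨_ | _⟩ | _ | _ | _ <;> try exact fun h => h.elim
    exact fun _ => EqDeriv.refl m
  | cons φ Γ ih =>
    rcases T with ⟨_ | _⟩ | _ | _ | _ <;> try exact fun h => h.elim
    exact fun h => ⟨(real_shift _ _ _ _ _).2 h.1, ih _ _ h.2⟩

/-- The entailment from `ψ` to `φ` is realized by a hereditarily primitive corecursive functional,
uniformly in the assignment. -/
def Realized (E : Set Equation) (G T : Ty) (ψ φ : Fml) : Prop :=
  ∃ r : G.El → T.El, (∀ γ, Hered G γ → Hered T fun x => r (γ x)) ∧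
    ∀ η γ, Real E ψ η G γ → Real E φ η T (r γ)

theorem realized_of_mem {E : Set Equation} {Γ : List Fml} {φ : Fml} (h : φ ∈ Γ) :
    Realized E (conj Γ).ty φ.ty (conj Γ) φ := by
  induction Γ with
  | nil => cases h
  | cons ψ Γ ih =>
    rcases List.mem_cons.1 h with rfl | h
    · exact ⟨Prod.fst, fun γ hγ => hγ.1, fun η γ hγ => hγ.1⟩
    · obtain ⟨r, hr, hr'⟩ := ih h
      exact ⟨fun γ => r γ.2, fun γ hγ => hr _ hγ.2, fun η γ hγ => hr' η _ hγ.2⟩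

/-- The realizer of coinduction is a corecursion over the coded realizers of the coinduction
formula. -/
theorem realized_coind {E : Set Equation} (hE : stdEqs ⊆ E) {G : Ty} {ψ φ : Fml} {t : Trm ℕ}
    (hφ : φ.StronglyPositive) (h₁ : Realized E G φ.ty ψ (φ.inst t))
    (h₂ : ∃ r : φ.ty.El × G.El → Bool × φ.ty.El × Unit,
      (∀ γ, Hered (Ty.prod φ.ty G) γ →
        Hered (Ty.prod (Ty.base Srt.B) (Ty.prod φ.ty Ty.unit)) fun x => r (γ x)) ∧
      ∀ η m v γ, Real E φ (extend m η) φ.ty v → Real E ψ η G γ →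
        Real E φ.dcm (extend m η) (Ty.prod (Ty.base Srt.B) (Ty.prod φ.ty Ty.unit)) (r (v, γ))) :
    Realized E G (Ty.base Srt.S) ψ (Fml.S t) := by
  obtain ⟨init, hinit, hinit'⟩ := h₁
  obtain ⟨step, hstep, hstep'⟩ := h₂
  obtain ⟨enc, dec, hdec, henc, hd⟩ := hφ.exists_code
  let run (γ : G.El) (v : φ.ty.El) : Stream' Bool :=
    Stream'.corec (fun v => (step (v, γ)).1) (fun v => (step (v, γ)).2.1) v
  have hrun (γ : G.El) (v : φ.ty.El) :
      run γ v = Stream'.cons (step (v, γ)).1 (run γ (step (v, γ)).2.1) := Stream'.corec_eq _ _ _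
  refine ⟨fun γ => run γ (init γ), fun γ hγ => ?_, fun η γ hγ => ?_⟩
  · -- a state consists of the parameter of the family and of the code of a realizer
    have hs := hstep (fun x => (dec x.odd, γ x.even))
      ⟨hd _ (.odd .id), hγ.comp (.even .id)⟩
    have key : Unary Srt.S fun x => run (γ x.even) (dec x.odd) := by
      refine .corec (g := fun x => x.even.interleave (enc (step (dec x.odd, γ x.even)).2.1))
        hs.1 (.interleave (.even .id) (henc _ hs.2.1)) fun x => ?_
      rw [Stream'.even_interleave, odd_interleave, hdec]
      exact hrun _ _
    have := key.comp (.interleave .id (henc _ (hinit γ hγ)))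
    simp only [Stream'.even_interleave, odd_interleave, hdec] at this
    exact this
  · refine StreamEq.coind hE
      (fun m s => ∃ v, Real E φ (extend m η) φ.ty v ∧ s = run γ v) ?_
      ⟨init γ, (real_inst _ _ _ _ _).1 (hinit' η γ hγ), rfl⟩
    rintro m _ ⟨v, hv, rfl⟩
    obtain ⟨z₀, z₁, h₀, h₁, h⟩ := (real_dcm _ _ _ _ _).1 (hstep' η m v γ hv hγ)
    rw [hrun]
    exact ⟨z₁, h.trans (.cons_congr h₀ (.refl _)), _, h₁, rfl⟩

/-- Soundness of `IT⁺` for realizability over the terms modulo a consistent program. -/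
theorem Prov.realized {E : Set Equation} (hE : stdEqs ⊆ E) (hcon : ∃ s t, ¬ EqDeriv E s t)
    {Γ : List Fml} {φ : Fml} (h : Prov E Γ φ) : Realized E (conj Γ).ty φ.ty (conj Γ) φ := by
  induction h with
  | hyp h => exact realized_of_mem h
  | andI _ _ ih₁ ih₂ =>
    obtain ⟨r₁, h₁, h₁'⟩ := ih₁
    obtain ⟨r₂, h₂, h₂'⟩ := ih₂
    exact ⟨fun γ => (r₁ γ, r₂ γ), fun γ hγ => ⟨h₁ γ hγ, h₂ γ hγ⟩,
      fun η γ hγ => ⟨h₁' η γ hγ, h₂' η γ hγ⟩⟩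
  | andE₁ _ ih =>
    obtain ⟨r, hr, hr'⟩ := ih
    exact ⟨fun γ => (r γ).1, fun γ hγ => (hr γ hγ).1, fun η γ hγ => (hr' η γ hγ).1⟩
  | andE₂ _ ih =>
    obtain ⟨r, hr, hr'⟩ := ih
    exact ⟨fun γ => (r γ).2, fun γ hγ => (hr γ hγ).2, fun η γ hγ => (hr' η γ hγ).2⟩
  | @orI₁ Γ φ ψ _ ih =>
    obtain ⟨r, hr, hr'⟩ := ih
    obtain ⟨d, hd⟩ := exists_hered_const ψ.ty
    exact ⟨fun γ => (false, r γ, d), fun γ hγ => ⟨Unary.zero, hr γ hγ, hd⟩,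
      fun η γ hγ => Or.inl ⟨rfl, hr' η γ hγ⟩⟩
  | @orI₂ Γ φ ψ _ ih =>
    obtain ⟨r, hr, hr'⟩ := ih
    obtain ⟨d, hd⟩ := exists_hered_const φ.ty
    exact ⟨fun γ => (true, d, r γ), fun γ hγ => ⟨Unary.one, hd, hr γ hγ⟩,
      fun η γ hγ => Or.inr ⟨rfl, hr' η γ hγ⟩⟩
  | orE _ _ _ ih ih₁ ih₂ =>
    obtain ⟨r, hr, hr'⟩ := ih
    obtain ⟨r₁, h₁, h₁'⟩ := ih₁
    obtain ⟨r₂, h₂, h₂'⟩ := ih₂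
    refine ⟨fun γ => cond (r γ).1 (r₂ ((r γ).2.2, γ)) (r₁ ((r γ).2.1, γ)), fun γ hγ => ?_,
      fun η γ hγ => ?_⟩
    · exact .cond (hr γ hγ).1 (h₂ _ ⟨(hr γ hγ).2.2, hγ⟩) (h₁ _ ⟨(hr γ hγ).2.1, hγ⟩)
    · rcases hr' η γ hγ with ⟨hb, h⟩ | ⟨hb, h⟩
      · change Real E _ η _ (cond (Prod.fst (r γ)) _ _)
        rw [hb]
        exact h₁' η _ ⟨h, hγ⟩
      · change Real E _ η _ (cond (Prod.fst (r γ)) _ _)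
        rw [hb]
        exact h₂' η _ ⟨h, hγ⟩
  | impI _ ih =>
    obtain ⟨r, hr, hr'⟩ := ih
    exact ⟨fun γ a => r (a, γ), fun γ hγ g hg a ha => hr _ ⟨ha, hγ.comp hg⟩,
      fun η γ hγ a ha => hr' η _ ⟨ha, hγ⟩⟩
  | impE _ _ ih₁ ih₂ =>
    obtain ⟨r₁, h₁, h₁'⟩ := ih₁
    obtain ⟨r₂, h₂, h₂'⟩ := ih₂
    exact ⟨fun γ => r₁ γ (r₂ γ), fun γ hγ => h₁ γ hγ _ .id _ (h₂ γ hγ),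
      fun η γ hγ => h₁' η γ hγ _ (h₂' η γ hγ)⟩
  | allI _ ih =>
    rw [conj_shift_ty] at ih
    obtain ⟨r, hr, hr'⟩ := ih
    exact ⟨r, hr, fun η γ hγ m => hr' _ _ (real_conj_shift _ _ _ _ _ hγ)⟩
  | @allE Γ φ t _ ih =>
    obtain ⟨r, hr, hr'⟩ := ih
    rw [Fml.ty_inst]
    exact ⟨r, hr, fun η γ hγ => (real_inst _ _ _ _ _).2 (hr' η γ hγ _)⟩
  | @exI Γ φ t _ ih =>
    rw [Fml.ty_inst] at ih
    obtain ⟨r, hr, hr'⟩ := ih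
    exact ⟨r, hr, fun η γ hγ => ⟨_, (real_inst _ _ _ _ _).1 (hr' η γ hγ)⟩⟩
  | @exE Γ φ χ _ _ ih₁ ih₂ =>
    rw [Fml.ty_shift, conj, Fml.ty, conj_shift_ty] at ih₂
    obtain ⟨r₁, h₁, h₁'⟩ := ih₁
    obtain ⟨r₂, h₂, h₂'⟩ := ih₂
    refine ⟨fun γ => r₂ (r₁ γ, γ), fun γ hγ => h₂ _ ⟨h₁ γ hγ, hγ⟩, fun η γ hγ => ?_⟩
    obtain ⟨m, hm⟩ := h₁' η γ hγ
    exact (real_shift _ _ m _ _).1 (h₂' (extend m η) (r₁ γ, γ)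
      ⟨hm, real_conj_shift _ _ _ _ _ hγ⟩)
  | eqRefl t => exact ⟨fun _ => (), fun _ _ => trivial, fun _ _ _ => EqDeriv.refl _⟩
  | @eqSubst Γ φ s t _ _ ih₁ ih₂ =>
    obtain ⟨r₁, h₁, h₁'⟩ := ih₁
    rw [Fml.ty_inst] at ih₂ ⊢
    obtain ⟨r₂, h₂, h₂'⟩ := ih₂
    refine ⟨r₂, h₂, fun η γ hγ => (real_inst _ _ _ _ _).2 (Real.congr (fun n => ?_)
      ((real_inst _ _ _ _ _).1 (h₂' η γ hγ)))⟩
    cases n with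
    | zero => exact h₁' η γ hγ
    | succ n => exact .refl _
  | prog e he σ =>
    refine ⟨fun _ => (), fun _ _ => trivial, fun η γ _ => ?_⟩
    have := EqDeriv.prog e he fun n => (σ n).subst η
    rw [← Trm.subst_subst, ← Trm.subst_subst] at this
    exact this
  | inj s t s' t' =>
    refine ⟨fun _ _ => ((), ()), fun _ _ _ _ _ _ => ⟨trivial, trivial⟩, fun η γ _ _ h => ?_⟩
    change EqDeriv E (Language.Term.subst _ _) (Language.Term.subst _ _) at h
    rw [Trm.subst_cons, Trm.subst_cons] at h
    exact EqDeriv.cons_inj hE h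
  | sep c d hcd ts us =>
    refine ⟨fun _ _ => (), fun _ _ _ _ _ _ => trivial, fun η γ _ _ h => ?_⟩
    obtain ⟨s, t, hst⟩ := hcon
    exact hst (EqDeriv.con_ne_con hE c d hcd _ _ h s t)
  | bZero => exact ⟨fun _ => false, fun _ _ => Unary.zero, fun η _ _ => by
      change EqDeriv E (Language.Term.subst Trm.zero η) Trm.zero
      rw [Trm.subst_zero]
      exact .refl _⟩
  | bOne => exact ⟨fun _ => true, fun _ _ => Unary.one, fun η _ _ => by
      change EqDeriv E (Language.Term.subst Trm.one η) Trm.one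
      rw [Trm.subst_one]
      exact .refl _⟩
  | @bInd Γ φ t _ _ _ ih ih₀ ih₁ =>
    rw [Fml.ty_inst] at ih₀ ih₁ ⊢
    obtain ⟨b, hb, hb'⟩ := ih
    obtain ⟨r₀, h₀, h₀'⟩ := ih₀
    obtain ⟨r₁, h₁, h₁'⟩ := ih₁
    refine ⟨fun γ => cond (b γ) (r₁ γ) (r₀ γ),
      fun γ hγ => .cond (hb γ hγ) (h₁ γ hγ) (h₀ γ hγ), fun η γ hγ => ?_⟩
    have ht : EqDeriv E (t.subst η) (boolTrm (b γ)) := hb' η γ hγ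
    have key (u : Trm ℕ) (r : φ.ty.El) (hu : u.subst η = boolTrm (b γ))
        (hr : Real E (φ.inst u) η φ.ty r) : Real E (φ.inst t) η φ.ty r := by
      rw [real_inst] at hr ⊢
      refine hr.congr fun n => ?_
      cases n with
      | zero => exact (hu ▸ ht).symm
      | succ n => exact .refl _
    change Real E _ η _ (cond (b γ) (r₁ γ) (r₀ γ))
    generalize b γ = c at key
    cases c with
    | false => exact key _ _ (Trm.subst_zero η) (h₀' η γ hγ)
    | true => exact key _ _ (Trm.subst_one η) (h₁' η γ hγ)
  | @sHd Γ s t _ ih =>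
    obtain ⟨r, hr, hr'⟩ := ih
    refine ⟨fun γ => Stream'.head (r γ), fun γ hγ => Unary.hd (hr γ hγ), fun η γ hγ => ?_⟩
    have := StreamEq.eq_cons (hr' η γ hγ)
    rw [Trm.subst_cons] at this
    exact (EqDeriv.cons_inj hE this).1
  | @sTl Γ s t _ ih =>
    obtain ⟨r, hr, hr'⟩ := ih
    refine ⟨fun γ => Stream'.tail (r γ), fun γ hγ => Unary.tl (hr γ hγ), fun η γ hγ => ?_⟩
    have := StreamEq.tail (hr' η γ hγ)
    rw [Trm.subst_cons] at this
    exact this.congr (.tl_cons hE _ _)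
  | @sDecomp Γ t _ ih =>
    obtain ⟨r, hr, hr'⟩ := ih
    rw [Fml.ty_inst, Fml.ty_dcm]
    refine ⟨fun γ => (Stream'.head (r γ), Stream'.tail (r γ), ()),
      fun γ hγ => ⟨Unary.hd (hr γ hγ), Unary.tl (hr γ hγ), trivial⟩, fun η γ hγ => ?_⟩
    have : StreamEq E (t.subst η) (r γ) := hr' η γ hγ
    exact (real_inst _ _ _ _ _).2 ((real_dcm _ _ _ (Ty.base Srt.S) _).2
      ⟨_, _, .refl _, this.tail, this.eq_cons⟩)
  | @coind Γ φ t hφ _ _ ih₁ ih₂ =>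
    rw [Fml.ty_inst] at ih₁
    rw [Fml.ty_dcm, conj, Fml.ty, conj_shift_ty] at ih₂
    obtain ⟨r, hr, hr'⟩ := ih₂
    exact realized_coind hE hφ ih₁
      ⟨r, hr, fun η m v γ hv hγ => hr' _ _ ⟨hv, real_conj_shift _ _ _ _ _ hγ⟩⟩

/-! ### Provable programs compute primitive corecursive functions -/

/-- The constant `0` or `1` of the canonical structure. -/
def Tree.ofBool : Bool → Tree
  | false => Tree.con Con.zero ![]
  | true => Tree.con Con.one ![]

theorem Tree.ofStream_eq (s : Stream' Bool) :
    Tree.ofStream s = Tree.con Con.cons ![Tree.ofBool s.head, Tree.ofStream s.tail] := by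
  have hb (b : Bool) : PFunctor.M.corec unfoldStep (Sum.inl b) = Tree.ofBool b := by
    rw [PFunctor.M.corec_def]
    cases b <;> exact congrArg PFunctor.M.mk (Sigma.ext rfl (heq_of_eq (funext fun i => i.elim0)))
  rw [Tree.ofStream, PFunctor.M.corec_def]
  refine congrArg PFunctor.M.mk (Sigma.ext rfl (heq_of_eq (funext fun i : Fin 2 => ?_)))
  match i with
  | 0 => exact hb _
  | 1 => rfl

theorem eqDeriv_const_ofBool (E : Set Equation) (b : Bool) :
    EqDeriv E (DTrm.const (Tree.ofBool b)) (boolTrm b) := by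
  cases b with
  | false => exact (EqDeriv.diag Con.zero ![]).trans (Trm.con_eq_zero (α := Tree ⊕ ℕ) _ ▸ .refl _)
  | true => exact (EqDeriv.diag Con.one ![]).trans (Trm.con_eq_one (α := Tree ⊕ ℕ) _ ▸ .refl _)

theorem streamEq_const {E : Set Equation} (hE : stdEqs ⊆ E) (s : Stream' Bool) :
    StreamEq E (DTrm.const (Tree.ofStream s)) s := by
  refine StreamEq.coind hE (fun m s => m = DTrm.const (Tree.ofStream s)) ?_ rfl
  rintro _ s rfl
  refine ⟨_, ?_, rfl⟩
  rw [Tree.ofStream_eq]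
  refine (EqDeriv.diag Con.cons _).trans ?_
  rw [Trm.con_eq_cons]
  exact .cons_congr (eqDeriv_const_ofBool E _) (.refl _)

/-- Terms that are provably equal to the same stream are observationally equal. -/
theorem StreamEq.omegaDeriv {E : Set Equation} (hE : stdEqs ⊆ E) {m m' : DTrm} {s : Stream' Bool}
    (hm : StreamEq E m s) (hm' : StreamEq E m' s) : OmegaDeriv E m m' := by
  have key (p : List Bool) : EqDeriv E (deepDestr p m) (deepDestr p m') ∨
      ∃ s, StreamEq E (deepDestr p m) s ∧ StreamEq E (deepDestr p m') s := by
    induction p with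
    | nil => exact Or.inr ⟨s, hm, hm'⟩
    | cons b p ih =>
      cases b <;> rcases ih with h | ⟨s, h, h'⟩
      · exact Or.inl h.hd_congr
      · exact Or.inl ((h.eq_cons.hd_congr.trans (.hd_cons hE _ _)).trans
          (h'.eq_cons.hd_congr.trans (.hd_cons hE _ _)).symm)
      · exact Or.inl h.tl_congr
      · exact Or.inr ⟨_, h.tail, h'.tail⟩
  intro p
  rcases key p with h | ⟨s, h, h'⟩
  · exact .disc_congr h _ _ _
  · exact ((EqDeriv.disc_congr h.eq_cons _ _ _).trans (.disc_cons hE _ _ _ _ _)).trans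
      ((EqDeriv.disc_congr h'.eq_cons _ _ _).trans (.disc_cons hE _ _ _ _ _)).symm

/-- A realizer of `S(t₁) → ⋯ → S(tₙ) → χ`, applied to realizers of the premises. -/
theorem exists_hered_foldr_imp {E : Set Equation} {χ : Fml}
    (L : List (Trm ℕ × (Stream' Bool → Stream' Bool))) (hL : ∀ p ∈ L, Unary Srt.S p.2)
    (r : Stream' Bool → ((L.map fun p => Fml.S p.1).foldr Fml.imp χ).ty.El) (hr : Hered _ r) :
    ∃ q : Stream' Bool → χ.ty.El, Hered χ.ty q ∧ ∀ x η,
      Real E ((L.map fun p => Fml.S p.1).foldr Fml.imp χ) η _ (r x) →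
        (∀ p ∈ L, StreamEq E (p.1.subst η) (p.2 x)) → Real E χ η χ.ty (q x) := by
  induction L with
  | nil => exact ⟨r, hr, fun x η h _ => h⟩
  | cons p L ih =>
    obtain ⟨q, hq, hq'⟩ := ih (fun p hp => hL p (List.mem_cons_of_mem _ hp))
      (fun x => r x (p.2 x)) (hr _ .id _ (hL p List.mem_cons_self))
    exact ⟨q, hq, fun x η h hp => hq' x η (h _ (hp p List.mem_cons_self))
      fun p hm => hp p (List.mem_cons_of_mem _ hm)⟩

theorem Program.Provable.exists_unary {k : ℕ} {P : Program k} (hP : P.Provable)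
    (hcon : ∃ s t, ¬ EqDeriv P.eqs s t) : ∃ q : Stream' Bool → Stream' Bool, Unary Srt.S q ∧
      ∀ a : Fin k → Stream' Bool, OmegaDeriv P.eqs
        (Trm.fn P.principal fun i => DTrm.const (Tree.ofStream (a i)))
        (DTrm.const (Tree.ofStream (q (pack a)))) := by
  have hL : productivity P.principal =
      ((List.ofFn fun i : Fin k => ((Trm.var (i : ℕ) : Trm ℕ), unpack i)).map
        fun p => Fml.S p.1).foldr Fml.imp
        (Fml.S (Trm.fn P.principal fun i : Fin k => Trm.var (i : ℕ))) := by
    rw [List.map_ofFn]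
    rfl
  rw [Program.Provable, hL] at hP
  obtain ⟨r, hr, hr'⟩ := hP.realized P.std hcon
  obtain ⟨q, hq, hq'⟩ := exists_hered_foldr_imp (E := P.eqs) _
    (fun p hp => by
      obtain ⟨i, rfl⟩ := List.mem_ofFn.1 hp
      exact unary_unpack i .id)
    (fun _ => r ()) (hr _ trivial)
  refine ⟨q, hq, fun a => ?_⟩
  let η : ℕ → DTrm := fun n =>
    if h : n < k then DTrm.const (Tree.ofStream (a ⟨n, h⟩)) else Trm.zero
  have hη (i : Fin k) : η i = DTrm.const (Tree.ofStream (a i)) := dif_pos i.2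
  have h := hq' (pack a) η (hr' η () (EqDeriv.refl _)) fun p hp => by
    obtain ⟨i, rfl⟩ := List.mem_ofFn.1 hp
    change StreamEq P.eqs (η i) (unpack i (pack a))
    rw [unpack_pack, hη]
    exact streamEq_const P.std _
  have h' : StreamEq P.eqs (Trm.fn P.principal fun i : Fin k => η i) (q (pack a)) := h
  simp only [hη] at h'
  exact h'.omegaDeriv P.std (streamEq_const P.std _)

theorem Tree.con_injective {n : ℕ} {c : Con n} {ts us : Fin n → Tree}
    (h : Tree.con c ts = Tree.con c us) : ts = us := by
  exact eq_of_heq (Sigma.ext_iff.1 (PFunctor.M.mk_inj h)).2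

theorem Tree.ofBool_injective : Function.Injective Tree.ofBool := by
  intro a b h
  cases a <;> cases b <;> first | rfl | cases (Sigma.ext_iff.1 (PFunctor.M.mk_inj h)).1

theorem Tree.ofStream_injective : Function.Injective Tree.ofStream := by
  intro s t h
  have key (n : ℕ) (s t : Stream' Bool) (h : Tree.ofStream s = Tree.ofStream t) :
      s.get n = t.get n := by
    induction n generalizing s t with
    | zero =>
      rw [Tree.ofStream_eq, Tree.ofStream_eq t] at h
      exact Tree.ofBool_injective (congrFun (Tree.con_injective h) 0)
    | succ n ih =>
      rw [Tree.ofStream_eq, Tree.ofStream_eq t] at h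
      exact ih s.tail t.tail (congrFun (Tree.con_injective h) 1)
  exact Stream'.ext fun n => key n s t h

theorem Program.Computes.consistent {k : ℕ} {P : Program k}
    {F : (Fin k → Stream' Bool) → Stream' Bool} (hF : P.Computes F) :
    ∃ s t, ¬ EqDeriv P.eqs s t := by
  by_contra! hcon
  -- in an inconsistent program every tree would be the value at every argument
  have h (b : Bool) := (hF (fun _ => Stream'.const false) (Tree.ofBool b)).1 fun p => hcon _ _
  exact Bool.false_ne_true (Tree.ofBool_injective ((h false).symm.trans (h true)))

theorem Program.Computes.primCorec {k : ℕ} {P : Program k}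
    {F : (Fin k → Stream' Bool) → Stream' Bool} (hF : P.Computes F) (hP : P.Provable) :
    PrimCorec (fun _ : Fin k => Srt.S) Srt.S F := by
  obtain ⟨q, hq, hq'⟩ := hP.exists_unary hF.consistent
  have h : F = fun a => q (pack a) :=
    funext fun a => Tree.ofStream_injective ((hF a _).1 (hq' a))
  rw [h]
  exact hq.primCorec_comp (primCorec_pack fun i => .proj (fun _ : Fin k => Srt.S) i)


/-! ### Models over the canonical structure -/

theorem Tree.cases_con (a : Tree) : (∃ ts, a = Tree.con Con.zero ts) ∨
    (∃ ts, a = Tree.con Con.one ts) ∨ ∃ ts, a = Tree.con Con.cons ts := by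
  rw [← PFunctor.M.mk_dest a]
  obtain ⟨⟨_, c⟩, ts⟩ := PFunctor.M.dest a
  cases c
  · exact Or.inl ⟨ts, rfl⟩
  · exact Or.inr (Or.inl ⟨ts, rfl⟩)
  · exact Or.inr (Or.inr ⟨ts, rfl⟩)

/-- The first destructor on trees, which fixes `0` and `1`. -/
def Tree.hd (a : Tree) : Tree :=
  match PFunctor.M.dest a with
  | ⟨⟨_, Con.cons⟩, ts⟩ => ts 0
  | _ => a

/-- The second destructor on trees, which fixes `0` and `1`. -/
def Tree.tl (a : Tree) : Tree :=
  match PFunctor.M.dest a with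
  | ⟨⟨_, Con.cons⟩, ts⟩ => ts 1
  | _ => a

/-- The discriminator on trees. -/
def Tree.disc (a x y z : Tree) : Tree :=
  match PFunctor.M.dest a with
  | ⟨⟨_, Con.zero⟩, _⟩ => x
  | ⟨⟨_, Con.one⟩, _⟩ => y
  | ⟨⟨_, Con.cons⟩, _⟩ => z

/-- An interpretation in the canonical structure of the function identifiers other than the
constructors, the destructors and the discriminator. -/
abbrev Interp : Type := ∀ n, ℕ → (Fin n → Tree) → Tree

/-- The function on trees denoted by a function identifier. -/
def symFn (I : Interp) : {n : ℕ} → Sym n → (Fin n → Tree) → Tree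
  | _, Sym.con c, a => Tree.con c a
  | _, Sym.fn PFn.hd, a => Tree.hd (a 0)
  | _, Sym.fn PFn.tl, a => Tree.tl (a 0)
  | _, Sym.fn PFn.disc, a => Tree.disc (a 0) (a 1) (a 2) (a 3)
  | _, Sym.fn (PFn.user n i), a => I n i a

/-- The value of a term in the canonical structure. -/
def eval (I : Interp) {α : Type} (η : α → Tree) : Trm α → Tree
  | Language.Term.var a => η a
  | Language.Term.func f ts => symFn I f fun i => eval I η (ts i)

section
variable {I : Interp} {α β : Type} {η : α → Tree}

@[simp] theorem eval_var (a : α) : eval I η (Trm.var a) = η a := rfl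

@[simp] theorem eval_zero : eval I η Trm.zero = Tree.ofBool false :=
  congrArg (Tree.con Con.zero) (funext fun i => i.elim0)

@[simp] theorem eval_one : eval I η Trm.one = Tree.ofBool true :=
  congrArg (Tree.con Con.one) (funext fun i => i.elim0)

@[simp] theorem eval_cons (s t : Trm α) :
    eval I η (Trm.cons s t) = Tree.con Con.cons ![eval I η s, eval I η t] :=
  congrArg (Tree.con Con.cons) (funext fun i => by fin_cases i <;> rfl)

@[simp] theorem eval_hd (t : Trm α) : eval I η (Trm.hd t) = Tree.hd (eval I η t) := rfl

@[simp] theorem eval_tl (t : Trm α) : eval I η (Trm.tl t) = Tree.tl (eval I η t) := rfl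

@[simp] theorem eval_disc (t x y z : Trm α) : eval I η (Trm.disc t x y z) =
    Tree.disc (eval I η t) (eval I η x) (eval I η y) (eval I η z) := rfl

theorem eval_subst (t : Trm α) (σ : α → Trm β) (θ : β → Tree) :
    eval I θ (Language.Term.subst t σ) = eval I (fun a => eval I θ (σ a)) t := by
  induction t with
  | var a => rfl
  | func f ts ih => exact congrArg (symFn I f) (funext ih)

@[simp] theorem Tree.hd_cons (ts : Fin 2 → Tree) : Tree.hd (Tree.con Con.cons ts) = ts 0 := rfl
@[simp] theorem Tree.tl_cons (ts : Fin 2 → Tree) : Tree.tl (Tree.con Con.cons ts) = ts 1 := rfl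
@[simp] theorem Tree.hd_ofBool (b : Bool) : Tree.hd (Tree.ofBool b) = Tree.ofBool b := by
  cases b <;> rfl
@[simp] theorem Tree.tl_ofBool (b : Bool) : Tree.tl (Tree.ofBool b) = Tree.ofBool b := by
  cases b <;> rfl
@[simp] theorem Tree.disc_ofBool (b : Bool) (x y z : Tree) :
    Tree.disc (Tree.ofBool b) x y z = cond b y x := by
  cases b <;> rfl
@[simp] theorem Tree.disc_cons (ts : Fin 2 → Tree) (x y z : Tree) :
    Tree.disc (Tree.con Con.cons ts) x y z = z := rfl
@[simp] theorem Tree.hd_ofStream (s : Stream' Bool) :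
    Tree.hd (Tree.ofStream s) = Tree.ofBool s.head := by
  rw [Tree.ofStream_eq, Tree.hd_cons]
  rfl
@[simp] theorem Tree.tl_ofStream (s : Stream' Bool) :
    Tree.tl (Tree.ofStream s) = Tree.ofStream s.tail := by
  rw [Tree.ofStream_eq, Tree.tl_cons]
  rfl

end

/-- Validity of an equation in the canonical structure. -/
def Equation.Valid (I : Interp) (e : Equation) : Prop :=
  ∀ η : ℕ → Tree, eval I η e.lhs = eval I η e.rhs

theorem valid_of_mem_stdEqs (I : Interp) {e : Equation} (he : e ∈ stdEqs) : e.Valid I := by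
  have hd (t q : Trm ℕ) (h : ∀ η : ℕ → Tree, eval I η (Trm.hd t) = eval I η q) :
      Equation.Valid I ⟨1, PFn.hd, ![t], q⟩ := h
  have tl (t q : Trm ℕ) (h : ∀ η : ℕ → Tree, eval I η (Trm.tl t) = eval I η q) :
      Equation.Valid I ⟨1, PFn.tl, ![t], q⟩ := h
  have disc (t x y z q : Trm ℕ) (h : ∀ η : ℕ → Tree, eval I η (Trm.disc t x y z) = eval I η q) :
      Equation.Valid I ⟨4, PFn.disc, ![t, x, y, z], q⟩ := h
  simp only [stdEqs, Set.mem_insert_iff, Set.mem_singleton_iff] at he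
  rcases he with rfl | rfl | rfl | rfl | rfl | rfl | rfl | rfl | rfl
  · exact hd _ _ fun η => by simp
  · exact hd _ _ fun η => by simp
  · exact hd _ _ fun η => by simp
  · exact tl _ _ fun η => by simp
  · exact tl _ _ fun η => by simp
  · exact tl _ _ fun η => by simp
  · exact disc _ _ _ _ _ fun η => by simp
  · exact disc _ _ _ _ _ fun η => by simp
  · exact disc _ _ _ _ _ fun η => by simp

theorem EqDeriv.eval_eq {E : Set Equation} {I : Interp} (hI : ∀ e ∈ E, e.Valid I) {s t : DTrm}
    (h : EqDeriv E s t) (ξ : ℕ → Tree) : eval I (Sum.elim id ξ) s = eval I (Sum.elim id ξ) t := by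
  induction h with
  | prog e he σ => rw [eval_subst, eval_subst]; exact hI e he _
  | diag c b => rfl
  | refl t => rfl
  | symm _ ih => exact ih.symm
  | trans _ _ ih₁ ih₂ => exact ih₁.trans ih₂
  | congr f ts us _ ih => exact congrArg (symFn I f) (funext ih)

/-- The subtree reached by a sequence of destructors. -/
def Tree.path : List Bool → Tree → Tree
  | [], a => a
  | false :: p, a => Tree.hd (Tree.path p a)
  | true :: p, a => Tree.tl (Tree.path p a)

theorem eval_deepDestr (I : Interp) (η : Tree ⊕ ℕ → Tree) (p : List Bool) (t : DTrm) :
    eval I η (deepDestr p t) = Tree.path p (eval I η t) := by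
  induction p with
  | nil => rfl
  | cons b p ih => cases b <;> simp [deepDestr, Tree.path, ih]

/-- Trees are determined by their observations. -/
theorem Tree.eq_of_disc_path {a b : Tree} (h : ∀ p x y z,
    Tree.disc (Tree.path p a) x y z = Tree.disc (Tree.path p b) x y z) : a = b := by
  have h01 : Tree.ofBool false ≠ Tree.ofBool true := fun h => by cases Tree.ofBool_injective h
  refine PFunctor.M.bisim (fun u v => ∃ p, u = Tree.path p a ∧ v = Tree.path p b) ?_ a b
    ⟨[], rfl, rfl⟩
  rintro u v ⟨p, rfl, rfl⟩
  have hp := h p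
  have nil (ts us : Fin 0 → Tree) (i : Fin 0) :
      ∃ p, ts i = Tree.path p a ∧ us i = Tree.path p b := i.elim0
  rcases Tree.cases_con (Tree.path p a) with ⟨ts, ha⟩ | ⟨ts, ha⟩ | ⟨ts, ha⟩ <;>
    rcases Tree.cases_con (Tree.path p b) with ⟨us, hb⟩ | ⟨us, hb⟩ | ⟨us, hb⟩ <;>
    rw [ha, hb] at hp ⊢
  · exact ⟨_, _, _, rfl, rfl, nil ts us⟩
  · exact absurd (hp (Tree.ofBool false) (Tree.ofBool true) (Tree.ofBool true)) h01
  · exact absurd (hp (Tree.ofBool false) (Tree.ofBool true) (Tree.ofBool true)) h01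
  · exact absurd (hp (Tree.ofBool true) (Tree.ofBool false) (Tree.ofBool true)) h01
  · exact ⟨_, _, _, rfl, rfl, nil ts us⟩
  · exact absurd (hp (Tree.ofBool true) (Tree.ofBool false) (Tree.ofBool true)) h01
  · exact absurd (hp (Tree.ofBool true) (Tree.ofBool true) (Tree.ofBool false)) h01
  · exact absurd (hp (Tree.ofBool true) (Tree.ofBool true) (Tree.ofBool false)) h01
  · refine ⟨_, _, _, rfl, rfl, fun i : Fin 2 => ?_⟩
    match i with
    | 0 => exact ⟨false :: p, by rw [Tree.path, ha]; rfl, by rw [Tree.path, hb]; rfl⟩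
    | 1 => exact ⟨true :: p, by rw [Tree.path, ha]; rfl, by rw [Tree.path, hb]; rfl⟩

/-- A provable program computes a function as soon as it has a model over the canonical structure
where its principal function extends that function: realizability yields some value, and the model
leaves no choice for it. -/
theorem Program.Provable.computes {k : ℕ} {P : Program k} (hP : P.Provable)
    {F : (Fin k → Stream' Bool) → Stream' Bool} {I : Interp} (hI : ∀ e ∈ P.eqs, e.Valid I)
    (hF : ∀ a : Fin k → Stream' Bool, (symFn I (Sym.fn P.principal) fun i => Tree.ofStream (a i)) =
      Tree.ofStream (F a)) : P.Computes F := by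
  have hcon : ∃ s t, ¬ EqDeriv P.eqs s t := by
    refine ⟨Trm.zero, Trm.one, fun h => ?_⟩
    have := h.eval_eq hI fun _ => Tree.ofBool false
    rw [eval_zero, eval_one] at this
    cases Tree.ofBool_injective this
  have key (a : Fin k → Stream' Bool) (b : Tree)
      (h : OmegaDeriv P.eqs (Trm.fn P.principal fun i => DTrm.const (Tree.ofStream (a i)))
        (DTrm.const b)) : Tree.ofStream (F a) = b := by
    refine Tree.eq_of_disc_path fun p x y z => ?_
    have := (h p).eval_eq hI fun n => if n = 0 then x else if n = 1 then y else z
    simp only [eval_disc, eval_deepDestr] at this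
    rw [← hF]
    exact this
  intro a b
  refine ⟨key a b, ?_⟩
  rintro rfl
  obtain ⟨q, -, hq⟩ := hP.exists_unary hcon
  rw [key a _ (hq a)]
  exact hq a

/-- One unfolding step of `Tree.corec`. The left summand carries the states and the right one the
heads, which are already trees. -/
def Tree.corecStep {X : Type} (h : X → Tree) (g : X → X) : X ⊕ Tree → conFunctor (X ⊕ Tree)
  | Sum.inl x => ⟨⟨2, Con.cons⟩, ![Sum.inr (h x), Sum.inl (g x)]⟩
  | Sum.inr a => PFunctor.map conFunctor Sum.inr (PFunctor.M.dest a)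

/-- Corecursion `f x = h x : f (g x)` in the canonical structure. -/
def Tree.corec {X : Type} (h : X → Tree) (g : X → X) (x : X) : Tree :=
  PFunctor.M.corec (Tree.corecStep h g) (Sum.inl x)

theorem Tree.corec_eq {X : Type} (h : X → Tree) (g : X → X) (x : X) :
    Tree.corec h g x = Tree.con Con.cons ![h x, Tree.corec h g (g x)] := by
  rw [Tree.corec, PFunctor.M.corec_def]
  refine congrArg PFunctor.M.mk (Sigma.ext rfl (heq_of_eq (funext fun i : Fin 2 => ?_)))
  match i with
  | 1 => rfl
  | 0 =>
    refine PFunctor.M.bisim (fun u v => u = PFunctor.M.corec (Tree.corecStep h g) (Sum.inr v)) ?_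
      _ (h x) rfl
    rintro _ v rfl
    rw [PFunctor.M.dest_corec]
    exact ⟨_, _, _, rfl, rfl, fun i => rfl⟩

theorem Tree.eq_ofStream_of_corec {Y : Type} (A : Y → Tree) (F : Y → Stream' Bool)
    (g : Y → Y) (h : ∀ y, A y = Tree.con Con.cons ![Tree.ofBool (F y).head, A (g y)])
    (hF : ∀ y, (F y).tail = F (g y)) (y : Y) : A y = Tree.ofStream (F y) := by
  refine PFunctor.M.bisim
    (fun u v => u = v ∨ ∃ y, u = A y ∧ v = Tree.ofStream (F y)) ?_ _ _ (Or.inr ⟨y, rfl, rfl⟩)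
  rintro u v (rfl | ⟨y, rfl, rfl⟩)
  · exact ⟨_, _, _, rfl, rfl, fun i => Or.inl rfl⟩
  · rw [h, Tree.ofStream_eq]
    refine ⟨_, _, _, rfl, rfl, fun i : Fin 2 => ?_⟩
    match i with
    | 0 => exact Or.inl rfl
    | 1 => exact Or.inr ⟨g y, rfl, congrArg Tree.ofStream (hF y)⟩


/-! ### Derived rules -/

/-- Weakening of a term by a fresh variable. -/
abbrev Trm.up (t : Trm ℕ) : Trm ℕ := Language.Term.subst t fun n => Trm.var (n + 1)

/-- The substitution that maps `0` to `t` and continues with `σ`. -/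
def scons (t : Trm ℕ) (σ : ℕ → Trm ℕ) : ℕ → Trm ℕ
  | 0 => t
  | n + 1 => σ n

@[simp] theorem scons_zero (t : Trm ℕ) (σ : ℕ → Trm ℕ) : scons t σ 0 = t := rfl

@[simp] theorem scons_succ (t : Trm ℕ) (σ : ℕ → Trm ℕ) (n : ℕ) : scons t σ (n + 1) = σ n := rfl

theorem Trm.subst_var_eq (t : Trm ℕ) : Language.Term.subst t Trm.var = t := by
  induction t with
  | var n => rfl
  | func f ts ih => exact congrArg _ (funext ih)

theorem Fml.inst_eq (φ : Fml) (t : Trm ℕ) : φ.inst t = φ.subst (scons t Trm.var) :=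
  congrArg (Fml.subst · φ) (funext fun n => by cases n <;> rfl)

@[simp] theorem Trm.up_subst_scons (s t : Trm ℕ) (σ : ℕ → Trm ℕ) :
    Language.Term.subst (Trm.up s) (scons t σ) = Language.Term.subst s σ :=
  Trm.subst_subst _ _ _

theorem Fml.subst_subst (φ : Fml) (σ τ : ℕ → Trm ℕ) :
    (φ.subst σ).subst τ = φ.subst fun n => (σ n).subst τ := by
  have lift (σ τ : ℕ → Trm ℕ) : (fun n => (liftSubst σ n).subst (liftSubst τ)) =
      liftSubst fun n => (σ n).subst τ := by
    funext n
    cases n with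
    | zero => rfl
    | succ n =>
      simp only [liftSubst, Trm.subst_subst]
      rfl
  induction φ generalizing σ τ <;> simp_all [Fml.subst, Trm.subst_subst]

namespace Prov
variable {E : Set Equation} {Γ : List Fml}

/-- Replacement of equals in a formula with a distinguished variable. -/
theorem rewrite (φ : Fml) {s t : Trm ℕ} {ψ χ : Fml} (h : Prov E Γ (Fml.eq s t))
    (hψ : Prov E Γ ψ) (h₁ : φ.subst (scons s Trm.var) = ψ) (h₂ : φ.subst (scons t Trm.var) = χ) :
    Prov E Γ χ := by
  rw [← h₂, ← Fml.inst_eq]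
  refine .eqSubst h ?_
  rwa [Fml.inst_eq, h₁]

theorem symm {s t : Trm ℕ} (h : Prov E Γ (Fml.eq s t)) : Prov E Γ (Fml.eq t s) :=
  rewrite (Fml.eq (Trm.var 0) s.up) h (.eqRefl s) (by simp [Fml.subst, Trm.subst_var_eq])
    (by simp [Fml.subst, Trm.subst_var_eq])

theorem trans {s t u : Trm ℕ} (h : Prov E Γ (Fml.eq s t)) (h' : Prov E Γ (Fml.eq t u)) :
    Prov E Γ (Fml.eq s u) :=
  rewrite (Fml.eq s.up (Trm.var 0)) h' h (by simp [Fml.subst, Trm.subst_var_eq])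
    (by simp [Fml.subst, Trm.subst_var_eq])

theorem hd_congr {s t : Trm ℕ} (h : Prov E Γ (Fml.eq s t)) :
    Prov E Γ (Fml.eq (Trm.hd s) (Trm.hd t)) :=
  rewrite (Fml.eq (Trm.hd s.up) (Trm.hd (Trm.var 0))) h
    (.eqRefl (Trm.hd s)) (by simp [Fml.subst, Trm.subst_var_eq]) (by simp [Fml.subst, Trm.subst_var_eq])

theorem tl_congr {s t : Trm ℕ} (h : Prov E Γ (Fml.eq s t)) :
    Prov E Γ (Fml.eq (Trm.tl s) (Trm.tl t)) :=
  rewrite (Fml.eq (Trm.tl s.up) (Trm.tl (Trm.var 0))) h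
    (.eqRefl (Trm.tl s)) (by simp [Fml.subst, Trm.subst_var_eq]) (by simp [Fml.subst, Trm.subst_var_eq])

end Prov

/-- The formula stating that a term has a given sort. -/
def Srt.fml : Srt → Trm ℕ → Fml
  | Srt.B => Fml.B
  | Srt.S => Fml.S

theorem Srt.fml_subst (ρ : Srt) (t : Trm ℕ) (σ : ℕ → Trm ℕ) :
    (ρ.fml t).subst σ = ρ.fml (Language.Term.subst t σ) := by
  cases ρ <;> rfl

namespace Prov
variable {E : Set Equation} {Γ : List Fml}

theorem fml_congr (ρ : Srt) {s t : Trm ℕ} (h : Prov E Γ (Fml.eq s t))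
    (hs : Prov E Γ (ρ.fml s)) : Prov E Γ (ρ.fml t) :=
  rewrite (ρ.fml (Trm.var 0)) h hs (ρ.fml_subst _ _) (ρ.fml_subst _ _)

theorem eq_hd_cons (hE : stdEqs ⊆ E) (s t : Trm ℕ) :
    Prov E Γ (Fml.eq (Trm.hd (Trm.cons s t)) s) := by
  have := Prov.prog (E := E) (Γ := Γ)
    ⟨1, PFn.hd, ![Trm.cons (Trm.var 0) (Trm.var 1)], Trm.var 0⟩
    (hE (by simp [stdEqs])) (scons s (scons t Trm.var))
  change Prov E Γ (Fml.eq (Language.Term.subst (Trm.hd _) _) _) at this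
  simpa using this

theorem eq_tl_cons (hE : stdEqs ⊆ E) (s t : Trm ℕ) :
    Prov E Γ (Fml.eq (Trm.tl (Trm.cons s t)) t) := by
  have := Prov.prog (E := E) (Γ := Γ)
    ⟨1, PFn.tl, ![Trm.cons (Trm.var 0) (Trm.var 1)], Trm.var 1⟩
    (hE (by simp [stdEqs])) (scons s (scons t Trm.var))
  change Prov E Γ (Fml.eq (Language.Term.subst (Trm.tl _) _) _) at this
  rw [Trm.subst_tl, Trm.subst_cons] at this
  exact this

theorem eq_disc_zero (hE : stdEqs ⊆ E) (x y z : Trm ℕ) :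
    Prov E Γ (Fml.eq (Trm.disc Trm.zero x y z) x) := by
  have := Prov.prog (E := E) (Γ := Γ)
    ⟨4, PFn.disc, ![Trm.zero, Trm.var 0, Trm.var 1, Trm.var 2], Trm.var 0⟩
    (hE (by simp [stdEqs])) (scons x (scons y (scons z Trm.var)))
  change Prov E Γ (Fml.eq (Language.Term.subst (Trm.disc _ _ _ _) _) _) at this
  rw [Trm.subst_disc, Trm.subst_zero] at this
  exact this

theorem eq_disc_one (hE : stdEqs ⊆ E) (x y z : Trm ℕ) :
    Prov E Γ (Fml.eq (Trm.disc Trm.one x y z) y) := by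
  have := Prov.prog (E := E) (Γ := Γ)
    ⟨4, PFn.disc, ![Trm.one, Trm.var 0, Trm.var 1, Trm.var 2], Trm.var 1⟩
    (hE (by simp [stdEqs])) (scons x (scons y (scons z Trm.var)))
  change Prov E Γ (Fml.eq (Language.Term.subst (Trm.disc _ _ _ _) _) _) at this
  rw [Trm.subst_disc, Trm.subst_one] at this
  exact this

/-- Introduction of an instance of the premise of coinduction. -/
theorem dcm_intro {φ : Fml} {a b : Trm ℕ} (σ : ℕ → Trm ℕ) (ha : Prov E Γ (Fml.B a))
    (hb : Prov E Γ (φ.subst (scons b fun n => σ (n + 1))))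
    (h : Prov E Γ (Fml.eq (σ 0) (Trm.cons a b))) : Prov E Γ (φ.dcm.subst σ) := by
  refine .exI a ?_
  rw [Fml.inst_eq]
  refine .exI b ?_
  rw [Fml.inst_eq]
  have cancel (t : Trm ℕ) : Language.Term.subst (Language.Term.subst t.up.up
      (liftSubst (scons a Trm.var))) (scons b Trm.var) = t := by
    simp only [Trm.up, Trm.subst_subst]
    exact Trm.subst_var_eq t
  refine .andI ?_ (.andI ?_ ?_)
  · change Prov E Γ (Fml.B (Language.Term.subst a.up (scons b Trm.var)))
    rwa [Trm.up_subst_scons, Trm.subst_var_eq]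
  · convert hb using 1
    simp only [Fml.subst_subst]
    refine congrArg (Fml.subst · φ) (funext fun n => ?_)
    cases n with
    | zero => rfl
    | succ n => exact cancel (σ (n + 1))
  · change Prov E Γ (Fml.eq (Language.Term.subst (Language.Term.subst (σ 0).up.up
      (liftSubst (scons a Trm.var))) (scons b Trm.var)) (Language.Term.subst (Language.Term.subst
      (Language.Term.subst (Trm.cons (Trm.var 1) (Trm.var 0)) _) _) _))
    rw [cancel]
    simp only [Trm.subst_cons]
    change Prov E Γ (Fml.eq (σ 0) (Trm.cons (Language.Term.subst a.up (scons b Trm.var)) b))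
    rwa [Trm.up_subst_scons, Trm.subst_var_eq]

end Prov

theorem Fml.dcm_S_subst (σ : ℕ → Trm ℕ) : (Fml.S (Trm.var 0)).dcm.subst σ =
    Fml.ex (Fml.ex (Fml.and (Fml.B (Trm.var 1)) (Fml.and (Fml.S (Trm.var 0))
      (Fml.eq (σ 0).up.up (Trm.cons (Trm.var 1) (Trm.var 0)))))) := by
  simp only [Fml.dcm, Fml.subst, Trm.subst_cons]
  rfl

namespace Prov
variable {E : Set Equation} {Γ : List Fml}

/-- Elimination of a decomposition `z₀ : z₁` of the value of the variable `0`. -/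
theorem dcm_elim {σ : ℕ → Trm ℕ} {χ : Fml} (ht : Prov E Γ ((Fml.S (Trm.var 0)).dcm.subst σ))
    (h : ∀ Δ, Prov E Δ (Fml.B (Trm.var 1)) → Prov E Δ (Fml.S (Trm.var 0)) →
      Prov E Δ (Fml.eq (σ 0).up.up (Trm.cons (Trm.var 1) (Trm.var 0))) →
        Prov E Δ χ.shift.shift) : Prov E Γ χ := by
  rw [Fml.dcm_S_subst] at ht
  exact .exE ht (.exE (.hyp List.mem_cons_self) (h _ (.andE₁ (.hyp List.mem_cons_self))
    (.andE₁ (.andE₂ (.hyp List.mem_cons_self))) (.andE₂ (.andE₂ (.hyp List.mem_cons_self)))))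

theorem stream_elim {t : Trm ℕ} {χ : Fml} (ht : Prov E Γ (Fml.S t))
    (h : ∀ Δ, Prov E Δ (Fml.B (Trm.var 1)) → Prov E Δ (Fml.S (Trm.var 0)) →
      Prov E Δ (Fml.eq t.up.up (Trm.cons (Trm.var 1) (Trm.var 0))) →
        Prov E Δ χ.shift.shift) : Prov E Γ χ := by
  have := Prov.sDecomp ht
  rw [Fml.inst_eq] at this
  exact dcm_elim this h

theorem bool_hd (hE : stdEqs ⊆ E) {t : Trm ℕ} (ht : Prov E Γ (Fml.S t)) :
    Prov E Γ (Fml.B (Trm.hd t)) := by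
  refine stream_elim ht fun Δ h₀ _ h => ?_
  simp only [Fml.shift, Fml.subst, Trm.subst_hd]
  exact fml_congr Srt.B ((hd_congr h).trans (eq_hd_cons hE _ _)).symm h₀

theorem stream_tl (hE : stdEqs ⊆ E) {t : Trm ℕ} (ht : Prov E Γ (Fml.S t)) :
    Prov E Γ (Fml.S (Trm.tl t)) := by
  refine stream_elim ht fun Δ _ h₁ h => ?_
  simp only [Fml.shift, Fml.subst, Trm.subst_tl]
  exact fml_congr Srt.S ((tl_congr h).trans (eq_tl_cons hE _ _)).symm h₁

/-- The introduction rule for streams follows by coinduction for the formula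
`∃ z₀ ∃ z₁ (B(z₀) ∧ S(z₁) ∧ x = z₀ : z₁)`. -/
theorem stream_cons {a t : Trm ℕ} (ha : Prov E Γ (Fml.B a)) (ht : Prov E Γ (Fml.S t)) :
    Prov E Γ (Fml.S (Trm.cons a t)) := by
  have pos : (Fml.S (Trm.var 0)).dcm.StronglyPositive :=
    .ex (.ex (.and (.B _) (.and (.S _) (.eq _ _))))
  refine .coind pos ?_ ?_
  · rw [Fml.inst_eq]
    exact dcm_intro _ ha ht (.eqRefl _)
  · have hyp : Prov E ((Fml.S (Trm.var 0)).dcm :: Γ.map Fml.shift)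
        ((Fml.S (Trm.var 0)).dcm.subst Trm.var) := by
      rw [Fml.dcm_S_subst]
      exact .hyp List.mem_cons_self
    refine dcm_elim hyp fun Δ h₀ h₁ h => ?_
    simp only [Fml.shift, Fml.subst_subst]
    refine dcm_intro _ h₀ ?_ h
    have := Prov.sDecomp h₁
    rw [Fml.inst_eq, Fml.dcm_S_subst] at this
    rw [Fml.dcm_S_subst]
    exact this

/-- Definition by cases preserves sorts, by induction for the booleans. -/
theorem fml_disc (hE : stdEqs ⊆ E) (ρ : Srt) {b x y z : Trm ℕ} (hb : Prov E Γ (Fml.B b))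
    (hx : Prov E Γ (ρ.fml x)) (hy : Prov E Γ (ρ.fml y)) :
    Prov E Γ (ρ.fml (Trm.disc b x y z)) := by
  have inst (b : Trm ℕ) : (ρ.fml (Trm.disc (Trm.var 0) x.up y.up z.up)).inst b =
      ρ.fml (Trm.disc b x y z) := by
    rw [Fml.inst_eq, ρ.fml_subst]
    simp [Trm.subst_var_eq]
  rw [← inst]
  refine .bInd hb ?_ ?_
  · rw [inst]
    exact fml_congr ρ (eq_disc_zero hE _ _ _).symm hx
  · rw [inst]
    exact fml_congr ρ (eq_disc_one hE _ _ _).symm hy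

end Prov

/-- A unary user-defined function applied to a term. -/
def Trm.app {α : Type} (i : ℕ) (t : Trm α) : Trm α := Trm.fn (PFn.user 1 i) ![t]

@[simp] theorem Trm.subst_app {α β : Type} (i : ℕ) (t : Trm α) (σ : α → Trm β) :
    Language.Term.subst (Trm.app i t) σ = Trm.app i (t.subst σ) :=
  congrArg (Language.Term.func _) (funext fun i => by fin_cases i; rfl)

/-- The function with `f(x) = h(x) : f(g(x))` is productive on every strongly positive predicate `p`
that is preserved by `g` and on which `h` is boolean-valued. The coinduction formula says of `z` that
`z = f(x)` for some `x` with `p(x)`. All variables of `p`, `h` and `g` stand for `x`. -/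
theorem Prov.stream_corec {E : Set Equation} {Γ : List Fml} {f : ℕ} {p : Fml} {h g : Trm ℕ}
    (hp : (p.subst fun _ => Trm.var 0).StronglyPositive)
    (hdef : ∀ (Δ : List Fml) (t : Trm ℕ), Prov E Δ (Fml.eq (Trm.app f t)
      (Trm.cons (h.subst fun _ => t) (Trm.app f (g.subst fun _ => t)))))
    (hh : ∀ (Δ : List Fml) (t : Trm ℕ), Prov E Δ (p.subst fun _ => t) →
      Prov E Δ (Fml.B (h.subst fun _ => t)))
    (hg : ∀ (Δ : List Fml) (t : Trm ℕ), Prov E Δ (p.subst fun _ => t) →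
      Prov E Δ (p.subst fun _ => g.subst fun _ => t))
    {t : Trm ℕ} (ht : Prov E Γ (p.subst fun _ => t)) : Prov E Γ (Fml.S (Trm.app f t)) := by
  have inst (Δ : List Fml) (u z : Trm ℕ) (σ : ℕ → Trm ℕ) (hu : Prov E Δ (p.subst fun _ => u))
      (hz : Prov E Δ (Fml.eq z (Trm.app f u))) :
      Prov E Δ ((Fml.ex ((p.subst fun _ => Trm.var 0).and
        (Fml.eq (Trm.var 1) (Trm.app f (Trm.var 0))))).subst (scons z σ)) := by
    refine .exI u ?_
    rw [Fml.inst_eq]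
    simp only [Fml.subst, Fml.subst_subst, Trm.subst_app]
    refine .andI hu ?_
    change Prov E Δ (Fml.eq (Language.Term.subst z.up (scons u Trm.var)) (Trm.app f u))
    rwa [Trm.up_subst_scons, Trm.subst_var_eq]
  refine .coind (.ex (.and hp (.eq (Trm.var 1) (Trm.app f (Trm.var 0))))) ?_ ?_
  · rw [Fml.inst_eq]
    exact inst _ _ _ _ ht (.eqRefl _)
  · refine .exE (.hyp List.mem_cons_self) ?_
    have hx (Δ : List Fml) := Prov.hyp (E := E) (List.mem_cons_self (l := Δ)
      (a := (p.subst fun _ => Trm.var 0).and (Fml.eq (Trm.var 1) (Trm.app f (Trm.var 0)))))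
    exact .dcm_intro _ (hh _ _ (hx _).andE₁) (inst _ _ _ _ (hg _ _ (hx _).andE₁) (.eqRefl _))
      ((hx _).andE₂.trans (hdef _ _))


/-! ### Building programs in stages -/

/-- The main function identifier of a term. -/
def topSym {α : Type} : Trm α → Option (Σ n, Sym n)
  | Language.Term.var _ => none
  | Language.Term.func f _ => some ⟨_, f⟩

/-- The main function identifier of the first argument of a term. -/
def argSym {α : Type} : Trm α → Option (Σ n, Sym n)
  | Language.Term.func (l := _ + 1) _ ts => topSym (ts 0)
  | _ => none

theorem stdEqs_compatible : stdEqs.Pairwise fun e e' => ¬ Unifiable e.lhs e'.lhs := by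
  rintro e he e' he' hne ⟨σ, τ, h⟩
  have h' := congrArg (fun t => (topSym t, argSym t)) h
  simp only [stdEqs, Set.mem_insert_iff, Set.mem_singleton_iff] at he he'
  rcases he with rfl | rfl | rfl | rfl | rfl | rfl | rfl | rfl | rfl <;>
    rcases he' with rfl | rfl | rfl | rfl | rfl | rfl | rfl | rfl | rfl <;>
    first
    | exact hne rfl
    | cases h'

/-- A finite program together with a model over the canonical structure. All its user-defined
identifiers have an index less than `bound`, and the equations hold in every interpretation that
agrees with the given one below `bound`, so that identifiers with larger indices remain free for
later definitions. -/
structure Stage where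
  eqs : Set Equation
  interp : Interp
  bound : ℕ
  finite : eqs.Finite
  std : stdEqs ⊆ eqs
  base : ∀ e ∈ eqs, ∀ i, IsBase (e.args i)
  compatible : eqs.Pairwise fun e e' => ¬ Unifiable e.lhs e'.lhs
  lt_bound : ∀ e ∈ eqs, ∀ n i, topSym e.lhs = some ⟨n, Sym.fn (PFn.user n i)⟩ → i < bound
  valid : ∀ I : Interp, (∀ n i, i < bound → I n i = interp n i) → ∀ e ∈ eqs, e.Valid I

/-- The interpretation `I` agrees with that of the stage on the identifiers in use. -/
def Stage.Agrees (S : Stage) (I : Interp) : Prop := ∀ n i, i < S.bound → I n i = S.interp n i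

/-- Extension of stages. -/
structure Stage.Le (S S' : Stage) : Prop where
  eqs : S.eqs ⊆ S'.eqs
  bound : S.bound ≤ S'.bound
  interp : S.Agrees S'.interp

theorem Stage.Le.refl (S : Stage) : S.Le S := ⟨subset_rfl, le_rfl, fun _ _ _ => rfl⟩

theorem Stage.Le.agrees {S S' : Stage} (h : S.Le S') {I : Interp} (hI : S'.Agrees I) : S.Agrees I :=
  fun n i hi => (hI n i (hi.trans_le h.bound)).trans (h.interp n i hi)

theorem Stage.Le.trans {S S' S'' : Stage} (h : S.Le S') (h' : S'.Le S'') : S.Le S'' :=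
  ⟨h.eqs.trans h'.eqs, h.bound.trans h'.bound, h.agrees h'.interp⟩

/-- The stage without user-defined functions. -/
def Stage.init : Stage where
  eqs := stdEqs
  interp := fun _ _ _ => Tree.ofBool false
  bound := 0
  finite := by simp [stdEqs]
  std := subset_rfl
  base := by
    have zero : IsBase Trm.zero := .con _ _ fun i => i.elim0
    have one : IsBase Trm.one := .con _ _ fun i => i.elim0
    have cons (m n : ℕ) : IsBase (Trm.cons (Trm.var m) (Trm.var n)) :=
      .con _ _ fun i => by fin_cases i <;> exact .var _
    intro e he
    simp only [stdEqs, Set.mem_insert_iff, Set.mem_singleton_iff] at he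
    rcases he with rfl | rfl | rfl | rfl | rfl | rfl | rfl | rfl | rfl <;> intro i <;>
      fin_cases i <;> first | exact zero | exact one | exact cons _ _ | exact .var _
  compatible := stdEqs_compatible
  lt_bound := by
    intro e he n i h
    simp only [stdEqs, Set.mem_insert_iff, Set.mem_singleton_iff] at he
    rcases he with rfl | rfl | rfl | rfl | rfl | rfl | rfl | rfl | rfl <;> cases h
  valid := fun I _ _ he => valid_of_mem_stdEqs I he

/-- The equation `f(x₀, …, xₙ₋₁) = q` for a user-defined function `f`. -/
def userEq (n i : ℕ) (q : Trm ℕ) : Equation := ⟨n, PFn.user n i, fun j => Trm.var (j : ℕ), q⟩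

/-- Explicit definition of the next free identifier. -/
theorem Stage.exists_add (S : Stage) (n : ℕ) (q : Trm ℕ) (A : (Fin n → Tree) → Tree)
    (hA : ∀ I, S.Agrees I → I n S.bound = A → ∀ η : ℕ → Tree, A (fun j => η j) = eval I η q) :
    ∃ S' : Stage, S.Le S' ∧ userEq n S.bound q ∈ S'.eqs ∧ S'.interp n S.bound = A ∧
      S.bound < S'.bound := by
  let I : Interp := Function.update S.interp n (Function.update (S.interp n) S.bound A)
  have hI : S.Agrees I := by
    intro m i hi
    by_cases h : m = n
    · subst h
      simp [I, hi.ne]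
    · simp [I, h]
  have hnew : topSym (userEq n S.bound q).lhs = some ⟨n, Sym.fn (PFn.user n S.bound)⟩ := rfl
  have hsym (e e' : Equation) (h : Unifiable e.lhs e'.lhs) : topSym e.lhs = topSym e'.lhs := by
    obtain ⟨σ, τ, h⟩ := h
    exact (congrArg topSym h : topSym (e.lhs.subst σ) = topSym (e'.lhs.subst τ))
  refine ⟨⟨insert (userEq n S.bound q) S.eqs, I, S.bound + 1, S.finite.insert _,
    S.std.trans (Set.subset_insert _ _), ?_, ?_, ?_, ?_⟩,
    ⟨Set.subset_insert _ _, Nat.le_succ _, hI⟩, Set.mem_insert _ _, by simp [I], Nat.lt_succ_self _⟩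
  · rintro e (rfl | he) i
    · exact .var _
    · exact S.base e he i
  · refine S.compatible.insert fun e he _ => ⟨fun h => ?_, fun h => ?_⟩
    · exact (S.lt_bound e he n S.bound ((hsym _ _ h).symm.trans hnew)).false
    · exact (S.lt_bound e he n S.bound ((hsym _ _ h).trans hnew)).false
  · rintro e (rfl | he) m i h
    · cases h
      exact Nat.lt_succ_self _
    · exact (S.lt_bound e he m i h).trans (Nat.lt_succ_self _)
  · rintro J hJ e (rfl | he) η
    · have hJ' : S.Agrees J := fun m i hi =>
        (hJ m i (hi.trans (Nat.lt_succ_self _))).trans (hI m i hi)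
      have hJn : J n S.bound = A := (hJ n _ (Nat.lt_succ_self _)).trans (by simp [I])
      rw [← show _ = eval J η (userEq n S.bound q).rhs from hA J hJ' hJn η, ← hJn]
      rfl
    · exact S.valid J (fun m i hi =>
        (hJ m i (hi.trans (Nat.lt_succ_self _))).trans (hI m i hi)) e he η

/-- The value of a term, all whose variables denote the same tree, depends only on the identifiers
in use. -/
def Stage.Closed (S : Stage) (t : Trm ℕ) : Prop :=
  ∀ I, S.Agrees I → ∀ a : Tree, eval I (fun _ => a) t = eval S.interp (fun _ => a) t

theorem Stage.Closed.mono {S S' : Stage} (h : S.Le S') {t : Trm ℕ} (ht : S.Closed t) :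
    S'.Closed t := fun I hI a =>
  (ht I (h.agrees hI) a).trans (ht _ h.interp a).symm

@[simp] theorem eval_app {I : Interp} {α : Type} {η : α → Tree} (i : ℕ) (t : Trm α) :
    eval I η (Trm.app i t) = I 1 i ![eval I η t] :=
  congrArg (I 1 i) (funext fun j => by fin_cases j; rfl)

/-- Definition by corecurrence `f(x) = h(x) : f(g(x))`, where `h` and `g` are well-typed for
arguments with the property `p`. -/
theorem Stage.exists_corec (S : Stage) {h g : Trm ℕ} (hcl : S.Closed h) (gcl : S.Closed g) {p : Fml}
    (hp : (p.subst fun _ => Trm.var 0).StronglyPositive)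
    (hh : ∀ E, S.eqs ⊆ E → ∀ (Δ : List Fml) (t : Trm ℕ), Prov E Δ (p.subst fun _ => t) →
      Prov E Δ (Fml.B (h.subst fun _ => t)))
    (hg : ∀ E, S.eqs ⊆ E → ∀ (Δ : List Fml) (t : Trm ℕ), Prov E Δ (p.subst fun _ => t) →
      Prov E Δ (p.subst fun _ => g.subst fun _ => t)) :
    ∃ S' : Stage, S.Le S' ∧ S.bound < S'.bound ∧
      (∀ a, S'.interp 1 S.bound ![a] = Tree.con Con.cons ![eval S.interp (fun _ => a) h,
        S'.interp 1 S.bound ![eval S.interp (fun _ => a) g] ]) ∧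
      ∀ E, S'.eqs ⊆ E → ∀ (Γ : List Fml) (t : Trm ℕ), Prov E Γ (p.subst fun _ => t) →
        Prov E Γ (Fml.S (Trm.app S.bound t)) := by
  let A : (Fin 1 → Tree) → Tree := fun a => Tree.corec (fun a => eval S.interp (fun _ => a) h)
    (fun a => eval S.interp (fun _ => a) g) (a 0)
  have hA (a : Tree) : A ![a] = Tree.con Con.cons ![eval S.interp (fun _ => a) h,
      A ![eval S.interp (fun _ => a) g] ] := Tree.corec_eq _ _ _
  let q : Trm ℕ := Trm.cons (h.subst fun _ => Trm.var 0)
    (Trm.app S.bound (g.subst fun _ => Trm.var 0))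
  obtain ⟨S', hle, hmem, hint, hlt⟩ := S.exists_add 1 q A fun I hI hIA η => by
    have : (fun j : Fin 1 => η j) = ![η 0] := funext fun j => by fin_cases j; rfl
    rw [this, hA]
    simp only [q, eval_cons, eval_app, eval_subst, eval_var, hcl I hI, gcl I hI, hIA]
  refine ⟨S', hle, hlt, fun a => by rw [hint, hA], fun E hE Γ t ht => ?_⟩
  refine Prov.stream_corec hp (fun Δ t => ?_) (hh E (hle.eqs.trans hE)) (hg E (hle.eqs.trans hE)) ht
  have := Prov.prog (Γ := Δ) _ (hE hmem) fun _ => t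
  have hl : (userEq 1 S.bound q).lhs.subst (fun _ => t) = Trm.app S.bound t :=
    congrArg (Language.Term.func _) (funext fun i => by fin_cases i; rfl)
  have hr : (userEq 1 S.bound q).rhs.subst (fun _ => t) = Trm.cons (h.subst fun _ => t)
      (Trm.app S.bound (g.subst fun _ => t)) := by
    simp only [userEq, q, Trm.subst_cons, Trm.subst_app, Trm.subst_subst, Trm.subst_var]
  rwa [hl, hr] at this

/-- The tree of a boolean or a stream. -/
def Srt.tree : (ρ : Srt) → ρ.El → Tree
  | Srt.B, b => Tree.ofBool b
  | Srt.S, s => Tree.ofStream s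

/-- The term `t` defines the function `f` in the stage, and is provably of sort `ρ` at streams. The
premise `S(s)` is required in every context, so that no weakening is needed later. -/
structure Represents (S : Stage) (ρ : Srt) (t : Trm ℕ) (f : Stream' Bool → ρ.El) : Prop where
  closed : S.Closed t
  eval_eq : ∀ s, eval S.interp (fun _ => Tree.ofStream s) t = ρ.tree (f s)
  typed : ∀ E, S.eqs ⊆ E → ∀ (Γ : List Fml) (s : Trm ℕ), Prov E Γ (Fml.S s) →
    Prov E Γ (ρ.fml (t.subst fun _ => s))

theorem Represents.mono {S S' : Stage} (h : S.Le S') {ρ : Srt} {t : Trm ℕ}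
    {f : Stream' Bool → ρ.El} (ht : Represents S ρ t f) : Represents S' ρ t f where
  closed := ht.closed.mono h
  eval_eq s := (ht.closed _ h.interp _).trans (ht.eval_eq s)
  typed E hE := ht.typed E (h.eqs.trans hE)

/-- The identifier `z` denotes interleaving of the two components of a tree `s : t`. -/
structure Stage.Interleaves (S : Stage) (z : ℕ) : Prop where
  lt : z < S.bound
  interp_eq : ∀ s t, S.interp 1 z ![Tree.con Con.cons ![Tree.ofStream s, Tree.ofStream t] ] =
    Tree.ofStream (s.interleave t)
  typed : ∀ E, S.eqs ⊆ E → ∀ (Γ : List Fml) (s t : Trm ℕ), Prov E Γ (Fml.S s) →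
    Prov E Γ (Fml.S t) → Prov E Γ (Fml.S (Trm.app z (Trm.cons s t)))

theorem Stage.Interleaves.mono {S S' : Stage} (h : S.Le S') {z : ℕ} (hz : S.Interleaves z) :
    S'.Interleaves z where
  lt := hz.lt.trans_le h.bound
  interp_eq s t := by rw [h.interp 1 z hz.lt, hz.interp_eq]
  typed E hE := hz.typed E (h.eqs.trans hE)

/-- Interleaving is unary corecurrence on pairs, which are represented by trees `s : t`. -/
theorem Stage.exists_interleaves (S : Stage) : ∃ S' : Stage, S.Le S' ∧ ∃ z, S'.Interleaves z := by
  let x : Trm ℕ := Trm.var 0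
  obtain ⟨S', hle, hlt, hS', typed⟩ := S.exists_corec (h := Trm.hd (Trm.hd x))
    (g := Trm.cons (Trm.tl x) (Trm.tl (Trm.hd x)))
    (p := (Fml.S (Trm.hd x)).and (Fml.S (Trm.tl x)))
    (fun I _ a => by simp [x]) (fun I _ a => by simp [x]) (.and (.S _) (.S _))
    (fun E hE Δ t ht => by
      simp only [Fml.subst, Trm.subst_hd] at ht ⊢
      exact .bool_hd (S.std.trans hE) ht.andE₁)
    (fun E hE Δ t ht => by
      simp only [Fml.subst, Trm.subst_hd, Trm.subst_tl, Trm.subst_cons] at ht ⊢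
      have hE := S.std.trans hE
      exact .andI (.fml_congr Srt.S (Prov.eq_hd_cons hE _ _).symm ht.andE₂)
        (.fml_congr Srt.S (Prov.eq_tl_cons hE _ _).symm (.stream_tl hE ht.andE₁)))
  refine ⟨S', hle, S.bound, hlt, fun s t => ?_, fun E hE Γ s t hs ht => typed E hE Γ _ ?_⟩
  · refine Tree.eq_ofStream_of_corec (Y := Stream' Bool × Stream' Bool)
      (fun y => S'.interp 1 S.bound ![Tree.con Con.cons ![Tree.ofStream y.1, Tree.ofStream y.2] ])
      (fun y => y.1.interleave y.2) (fun y => (y.2, y.1.tail)) (fun y => ?_) (fun y => ?_) (s, t)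
    · exact (hS' _).trans (by simp [x, interleave_eq_cons y.1 y.2])
    · exact Stream'.tail_interleave _ _
  · have hE := S'.std.trans hE
    simp only [Fml.subst, Trm.subst_hd, Trm.subst_tl]
    exact .andI (.fml_congr Srt.S (Prov.eq_hd_cons hE _ _).symm hs)
      (.fml_congr Srt.S (Prov.eq_tl_cons hE _ _).symm ht)

theorem Unary.exists_represents {ρ : Srt} {f : Stream' Bool → ρ.El} (hf : Unary ρ f) (S : Stage) :
    ∃ S' : Stage, S.Le S' ∧ ∃ t, Represents S' ρ t f := by
  induction hf generalizing S with
  | zero =>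
    exact ⟨S, .refl S, Trm.zero, fun _ _ _ => by simp, fun _ => eval_zero, fun E hE Γ s _ => by
      rw [Trm.subst_zero]
      exact .bZero⟩
  | one =>
    exact ⟨S, .refl S, Trm.one, fun _ _ _ => by simp, fun _ => eval_one, fun E hE Γ s _ => by
      rw [Trm.subst_one]
      exact .bOne⟩
  | @cons b s _ _ ihb ihs =>
    obtain ⟨S₁, h₁, tb, hb⟩ := ihb S
    obtain ⟨S₂, h₂, ts, hs⟩ := ihs S₁
    replace hb := hb.mono h₂
    refine ⟨S₂, h₁.trans h₂, Trm.cons tb ts, fun I hI a => ?_, fun x => ?_, fun E hE Γ x hx => ?_⟩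
    · simp [hb.closed I hI, hs.closed I hI]
    · rw [eval_cons, hb.eval_eq, hs.eval_eq]
      exact (Tree.ofStream_eq (Stream'.cons (b x) (s x))).symm
    · rw [Trm.subst_cons]
      exact .stream_cons (hb.typed E hE Γ x hx) (hs.typed E hE Γ x hx)
  | @hd s _ ih =>
    obtain ⟨S₁, h₁, t, ht⟩ := ih S
    refine ⟨S₁, h₁, Trm.hd t, fun I hI a => ?_, fun x => ?_, fun E hE Γ x hx => ?_⟩
    · simp [ht.closed I hI]
    · rw [eval_hd, ht.eval_eq]
      exact Tree.hd_ofStream _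
    · rw [Trm.subst_hd]
      exact .bool_hd (S₁.std.trans hE) (ht.typed E hE Γ x hx)
  | @tl s _ ih =>
    obtain ⟨S₁, h₁, t, ht⟩ := ih S
    refine ⟨S₁, h₁, Trm.tl t, fun I hI a => ?_, fun x => ?_, fun E hE Γ x hx => ?_⟩
    · simp [ht.closed I hI]
    · rw [eval_tl, ht.eval_eq]
      exact Tree.tl_ofStream _
    · rw [Trm.subst_tl]
      exact .stream_tl (S₁.std.trans hE) (ht.typed E hE Γ x hx)
  | @cond ρ b f g _ _ _ ihb ihf ihg =>
    obtain ⟨S₁, h₁, tb, hb⟩ := ihb S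
    obtain ⟨S₂, h₂, tf, hf⟩ := ihf S₁
    obtain ⟨S₃, h₃, tg, hg⟩ := ihg S₂
    replace hb := hb.mono (h₂.trans h₃)
    replace hf := hf.mono h₃
    -- the last argument of the discriminator is irrelevant
    refine ⟨S₃, h₁.trans (h₂.trans h₃), Trm.disc tb tg tf tg, fun I hI a => ?_, fun x => ?_,
      fun E hE Γ x hx => ?_⟩
    · simp [hb.closed I hI, hf.closed I hI, hg.closed I hI]
    · rw [eval_disc, hb.eval_eq, hf.eval_eq, hg.eval_eq]
      refine (Tree.disc_ofBool _ _ _ _).trans ?_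
      cases b x <;> rfl
    · rw [Trm.subst_disc]
      exact .fml_disc (S₃.std.trans hE) ρ (hb.typed E hE Γ x hx) (hg.typed E hE Γ x hx)
        (hf.typed E hE Γ x hx)
  | id => exact ⟨S, .refl S, Trm.var 0, fun _ _ _ => rfl, fun _ => rfl, fun _ _ _ _ hx => hx⟩
  | @comp ρ f g _ _ ihf ihg =>
    obtain ⟨S₁, h₁, tf, hf⟩ := ihf S
    obtain ⟨S₂, h₂, tg, hg⟩ := ihg S₁
    replace hf := hf.mono h₂
    refine ⟨S₂, h₁.trans h₂, tf.subst fun _ => tg, fun I hI a => ?_, fun x => ?_,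
      fun E hE Γ x hx => ?_⟩
    · rw [eval_subst, eval_subst, hg.closed I hI, hf.closed I hI]
    · rw [eval_subst, hg.eval_eq]
      exact hf.eval_eq (g x)
    · rw [Trm.subst_subst]
      exact hf.typed E hE Γ _ (hg.typed E hE Γ x hx)
  | @interleave f g _ _ ihf ihg =>
    obtain ⟨S₁, h₁, tf, hf⟩ := ihf S
    obtain ⟨S₂, h₂, tg, hg⟩ := ihg S₁
    obtain ⟨S₃, h₃, z, hz⟩ := S₂.exists_interleaves
    replace hf := hf.mono (h₂.trans h₃)
    replace hg := hg.mono h₃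
    refine ⟨S₃, h₁.trans (h₂.trans h₃), Trm.app z (Trm.cons tf tg), fun I hI a => ?_, fun x => ?_,
      fun E hE Γ x hx => ?_⟩
    · simp [hf.closed I hI, hg.closed I hI, hI 1 z hz.lt]
    · rw [eval_app, eval_cons, hf.eval_eq, hg.eval_eq]
      exact hz.interp_eq _ _
    · rw [Trm.subst_app, Trm.subst_cons]
      exact hz.typed E hE Γ _ _ (hf.typed E hE Γ x hx) (hg.typed E hE Γ x hx)
  | @corec h g f _ _ hdef ihh ihg =>
    obtain ⟨S₁, h₁, th, hh⟩ := ihh S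
    obtain ⟨S₂, h₂, tg, hg⟩ := ihg S₁
    replace hh := hh.mono h₂
    obtain ⟨S₃, h₃, hlt, hS₃, typed⟩ := S₂.exists_corec (p := Fml.S (Trm.var 0)) hh.closed hg.closed
      (.S _) hh.typed hg.typed
    refine ⟨S₃, h₁.trans (h₂.trans h₃), Trm.app S₂.bound (Trm.var 0), fun I hI a => ?_, fun x => ?_,
      fun E hE Γ x hx => ?_⟩
    · simp [hI 1 _ hlt]
    · rw [eval_app, eval_var]
      refine Tree.eq_ofStream_of_corec (fun x => S₃.interp 1 S₂.bound ![Tree.ofStream x]) f g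
        (fun x => ?_) (fun x => ?_) x
      · rw [hS₃, hh.eval_eq, hg.eval_eq, hdef]
        rfl
      · rw [hdef]
        rfl
    · rw [Trm.subst_app]
      exact typed E hE Γ x hx

/-- The constant stream `0 : 0 : ⋯` as the value of `f(x) = 0 : f(x)` at `0`. There may be no
stream variable at hand, hence the argument is not one. -/
theorem Stage.exists_const_false (S : Stage) : ∃ S' : Stage, S.Le S' ∧ ∃ c, c < S'.bound ∧
    S'.interp 1 c ![Tree.ofBool false] = Tree.ofStream (Stream'.const false) ∧
    ∀ E, S'.eqs ⊆ E → ∀ Γ, Prov E Γ (Fml.S (Trm.app c Trm.zero)) := by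
  obtain ⟨S', hle, hlt, hS', typed⟩ := S.exists_corec (h := Trm.zero) (g := Trm.var 0)
    (p := Fml.eq (Trm.var 0) Trm.zero) (fun I _ a => by simp) (fun I _ a => rfl)
    (.eq _ _) (fun E _ Δ t _ => by
      rw [Trm.subst_zero]
      exact .bZero) (fun E _ Δ t ht => ht)
  refine ⟨S', hle, S.bound, hlt, ?_, fun E hE Γ => typed E hE Γ _ ?_⟩
  · exact Tree.eq_ofStream_of_corec (Y := Unit) (fun _ => S'.interp 1 S.bound ![Tree.ofBool false])
      (fun _ => Stream'.const false) id
      (fun _ => (hS' _).trans (by simp only [eval_zero, eval_var]; rfl)) (fun _ => rfl) ()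
  · simp only [Fml.subst, Trm.subst_zero]
    exact .eqRefl _

/-- A tuple of terms packed by iterated interleaving. -/
def packTrm (z c : ℕ) : {n : ℕ} → (Fin n → Trm ℕ) → Trm ℕ
  | 0, _ => Trm.app c Trm.zero
  | _ + 1, ts => Trm.app z (Trm.cons (ts 0) (packTrm z c fun i => ts i.succ))

theorem foldr_imp_intro {E : Set Equation} {χ : Fml} (L Γ : List Fml)
    (h : ∀ Δ, (∀ φ ∈ Γ, φ ∈ Δ) → (∀ φ ∈ L, φ ∈ Δ) → Prov E Δ χ) :
    Prov E Γ (L.foldr Fml.imp χ) := by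
  induction L generalizing Γ with
  | nil => exact h Γ (fun _ h => h) (by simp)
  | cons ψ L ih =>
    refine .impI (ih _ fun Δ h₁ h₂ => h Δ (fun φ hφ => h₁ φ (List.mem_cons_of_mem _ hφ)) ?_)
    intro φ hφ
    rcases List.mem_cons.1 hφ with rfl | hφ
    · exact h₁ _ List.mem_cons_self
    · exact h₂ φ hφ

/-- Every primitive corecursive function is computed by a provable program. -/
theorem PrimCorec.exists_program {k : ℕ} {F : (Fin k → Stream' Bool) → Stream' Bool}
    (hF : PrimCorec (fun _ : Fin k => Srt.S) Srt.S F) :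
    ∃ P : Program k, P.Computes F ∧ P.Provable := by
  obtain ⟨S₁, -, z, hz⟩ := Stage.init.exists_interleaves
  obtain ⟨S₂, h₂, c, hc, hceval, hctyped⟩ := S₁.exists_const_false
  obtain ⟨S₃, h₃, t, ht⟩ := hF.unary.exists_represents S₂
  replace hz := hz.mono (h₂.trans h₃)
  replace hceval := (congrFun (h₃.interp 1 c hc) _).trans hceval
  replace hctyped := fun E hE => hctyped E (h₃.eqs.trans hE)
  replace hc := hc.trans_le h₃.bound
  have pack_closed {n : ℕ} (v : Fin n → ℕ) (I : Interp) (hI : S₃.Agrees I) (η θ : ℕ → Tree)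
      (h : ∀ i, η (v i) = θ (v i)) : eval I η (packTrm z c fun i => Trm.var (v i)) =
        eval S₃.interp θ (packTrm z c fun i => Trm.var (v i)) := by
    induction n with
    | zero => simp [packTrm, hI 1 c hc]
    | succ n ih => simp [packTrm, hI 1 z hz.lt, h, ih (fun i => v i.succ) fun i => h i.succ]
  have pack_eval {n : ℕ} (v : Fin n → ℕ) (a : Fin n → Stream' Bool) (η : ℕ → Tree)
      (hη : ∀ i, η (v i) = Tree.ofStream (a i)) :
      eval S₃.interp η (packTrm z c fun i => Trm.var (v i)) = Tree.ofStream (pack a) := by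
    induction n with
    | zero =>
      simp only [packTrm, eval_app, eval_zero]
      exact hceval
    | succ n ih =>
      rw [packTrm, eval_app, eval_cons, ih (fun i => v i.succ) (fun i => a i.succ) fun i => hη _,
        eval_var, hη, hz.interp_eq]
      rfl
  have pack_typed {n : ℕ} (v : Fin n → ℕ) (E : Set Equation) (hE : S₃.eqs ⊆ E) (Γ : List Fml)
      (h : ∀ i, Prov E Γ (Fml.S (Trm.var (v i)))) :
      Prov E Γ (Fml.S (packTrm z c fun i => Trm.var (v i))) := by
    induction n with
    | zero => exact hctyped E hE Γ
    | succ n ih => exact hz.typed E hE Γ _ _ (h 0) (ih (fun i => v i.succ) fun i => h i.succ)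
  let u : Trm ℕ := packTrm z c fun i : Fin k => Trm.var (i : ℕ)
  let θ (a : Fin k → Tree) (n : ℕ) : Tree := if h : n < k then a ⟨n, h⟩ else Tree.ofBool false
  have hθ (a : Fin k → Tree) (i : Fin k) : θ a i = a i := dif_pos i.2
  obtain ⟨S₄, h₄, hmem, hint, -⟩ := S₃.exists_add k (t.subst fun _ => u)
    (fun a => eval S₃.interp (θ a) (t.subst fun _ => u)) fun I hI _ η => by
      rw [eval_subst, eval_subst, ht.closed I hI,
        pack_closed _ I hI η (θ fun j => η j) fun i => (hθ (fun j => η j) i).symm]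
  let P : Program k := ⟨S₄.eqs, S₄.finite, S₄.base, S₄.compatible, S₄.std, PFn.user k S₃.bound⟩
  have hP : P.Provable := by
    refine foldr_imp_intro _ _ fun Δ _ hΔ => ?_
    have hu : Prov S₄.eqs Δ (Fml.S u) := pack_typed _ _ h₄.eqs Δ fun i =>
      .hyp (hΔ _ (List.mem_ofFn.2 ⟨i, rfl⟩))
    have := Prov.prog (Γ := Δ) _ hmem Trm.var
    rw [Trm.subst_var_eq, Trm.subst_var_eq] at this
    exact .fml_congr Srt.S this.symm (ht.typed _ h₄.eqs Δ u hu)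
  refine ⟨P, hP.computes (I := S₄.interp) (S₄.valid _ fun _ _ _ => rfl) fun a => ?_, hP⟩
  change S₄.interp k S₃.bound (fun i => Tree.ofStream (a i)) = _
  rw [hint]
  change eval S₃.interp _ (t.subst fun _ => u) = _
  rw [eval_subst, pack_eval _ a _ fun i => hθ _ i, ht.eval_eq,
    show pack a = encArgs (fun _ : Fin k => Srt.S) a from rfl, decArgs_encArgs]
  rfl

end BoolStream

/-- A function over boolean streams is primitive corecursive iff it is computed by some equational
program whose productivity is provable in `IT⁺`. -/
theorem mainTheorem1 (k : ℕ) (F : (Fin k → Stream' Bool) → Stream' Bool) :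
    BoolStream.PrimCorec (fun _ : Fin k => BoolStream.Srt.S) BoolStream.Srt.S F ↔
      ∃ P : BoolStream.Program k, P.Computes F ∧ P.Provable :=
  ⟨fun hF => hF.exists_program, fun ⟨_, hF, hP⟩ => hF.primCorec hP⟩
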